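/- A Feynman diagram of order $n$ is a finite graph (loops and multiple edges allowed) with $2n$ vertices, all of degree $1$ (legs) or $3$, with a cyclic ordering of the set of legs (which are placed on an oriented circle, the Wilson line) and a cyclic ordering of the three half-edges at each trivalent vertex, and with at least one leg on each connected component. It is connected if the graph, without the Wilson line, is connected. A chord diagram is a Feynman diagram without trivalent vertices. Let $k$ be a field and let $\mathcal A_n$ be the $k$-vector space spanned by the isomorphism classes of Feynman diagrams of order $n$ modulo the three-term relations $D_Y=D_{\parallel}-D_X$: here $D_Y$ has a leg joined to a trivalent vertex with half-edges, in counterclockwise order, (stem, $b$, $c$); the leg, the stem and the vertex are removed, and the strands of $b$ and $c$ end instead at two adjacent points of the (counterclockwise) Wilson line at the place of the leg, in the order $c,b$ in $D_{\parallel}$ and in the order $b,c$ in $D_X$. Let $\mathcal A_n^{(\ell)}\subset\mathcal A_n$ be the subspace spanned by the Feynman diagrams with at most $\ell$ legs. The Alexander–Conway weight system of order $n$ is the linear functional $C$ on $\mathcal A_n$ whose value on a chord diagram $D$ is $1$ if smoothing the Wilson line at all chords (arriving at an end of a chord, switch to its other end and continue along the Wilson line) produces a single closed curve, and $0$ otherwise.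 This is the weight system of the coefficient of $z^n$ in the Conway polynomial, as given by the skein relation $\nabla(L_+)-\nabla(L_-)=z\nabla(L_0)$. **Proposition 5.4.** Let $n\ge 2$. There is exactly one linear functional $C$ on $\mathcal A_n$ with these values on chord diagrams, and: 1. $C(F)=0$ for each connected Feynman diagram $F$ of order $n$ whose class lies in $\mathcal A_n^{(n-1)}$, in particular for each connected $F$ with at most $n-1$ legs; 2. for the wheel $w_n$ with $n$ spokes (a cycle of $n$ trivalent vertices, each joined to a leg, drawn in the plane inside the Wilson line with the counterclockwise orientations), $C(w_n)=-2$ if $n$ is even and $C(w_n)=0$ if $n$ is odd. -/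

import Mathlib

set_option linter.unusedSimpArgs false

namespace AlexanderConway

/-- A Feynman diagram of order `n`: a finite graph with `2 * n` vertices, all of degree 1 or 3,
with a cyclic ordering of the univalent vertices (the legs, placed on the Wilson line) and a cyclic
ordering of the three edge-ends at every trivalent vertex, each connected component containing
at least one leg.  Multiple edges and loops are allowed, so the graph is given by its half-edges:

* `edge` exchanges the two halves of each edge;
* the cycles of `rot` are the vertices, and `rot` is the cyclic ordering at each of them
  (a fixed point is a univalent vertex, a 3-cycle is a trivalent vertex);
* `wilson` sends each leg to the next leg in the cyclic ordering of the legs. -/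
structure FeynmanDiagram (n : ℕ) where
  HalfEdge : Type
  finite : Finite HalfEdge
  edge : Equiv.Perm HalfEdge
  edge_edge : ∀ h, edge (edge h) = h
  edge_ne : ∀ h, edge h ≠ h
  rot : Equiv.Perm HalfEdge
  rot_rot_rot : ∀ h, rot (rot (rot h)) = h
  card_vertices : Nat.card (Quotient (Equiv.Perm.SameCycle.setoid rot)) = 2 * n
  wilson : Equiv.Perm HalfEdge
  /-- `wilson` is extended by the identity to the half-edges that are not legs. -/
  wilson_of_not_leg : ∀ h, rot h ≠ h → wilson h = h
  /-- The legs form one single cycle. -/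
  wilson_cycle : ∀ h h', rot h = h → rot h' = h' → wilson.SameCycle h h'
  /-- Each connected component of the graph (without the Wilson line) has a leg. -/
  exists_leg : ∀ h, ∃ l, rot l = l ∧
    Relation.ReflTransGen (fun x y => y = edge x ∨ y = rot x) h l

namespace FeynmanDiagram

variable {n : ℕ}

/-- A half-edge is a leg if its vertex is univalent. -/
def IsLeg (F : FeynmanDiagram n) (h : F.HalfEdge) : Prop := F.rot h = h

/-- The number of legs. -/
noncomputable def numLegs (F : FeynmanDiagram n) : ℕ := Nat.card {h : F.HalfEdge // F.IsLeg h}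

/-- The graph, without the Wilson line, is connected. -/
def IsConnected (F : FeynmanDiagram n) : Prop :=
  Nonempty F.HalfEdge ∧
    ∀ h h' : F.HalfEdge, Relation.ReflTransGen (fun x y => y = F.edge x ∨ y = F.rot x) h h'

/-- Isomorphism of graphs with orientations. -/
def Iso (F G : FeynmanDiagram n) : Prop :=
  ∃ e : F.HalfEdge ≃ G.HalfEdge,
    (∀ h, e (F.edge h) = G.edge (e h)) ∧ (∀ h, e (F.rot h) = G.rot (e h)) ∧
      ∀ h, e (F.wilson h) = G.wilson (e h)

/-- A chord diagram is a Feynman diagram without trivalent vertices: `2 * n` points on an oriented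
circle, joined in pairs by `n` chords. -/
def IsChordDiagram (F : FeynmanDiagram n) : Prop := ∀ h, F.IsLeg h

open Classical in
/-- `IsResolution D D' l x y`: the leg `l` of `D` is joined by an edge to a trivalent vertex `v`,
the two other half-edges at `v` are `x` and `y`, and `D'` results from `D` by deleting `l`, its edge
and `v`, and by ending the two strands of `x` and `y` on the Wilson line instead, at two adjacent
points at the former place of `l`, first `x` and then `y` in the direction of the Wilson line.
The map `i` is the inclusion of the half-edges of `D'` in those of `D`. -/
def IsResolution (D D' : FeynmanDiagram n) (l x y : D.HalfEdge) : Prop :=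
  ∃ i : D'.HalfEdge → D.HalfEdge,
    Function.Injective i ∧ Set.range i = {l, D.edge l}ᶜ ∧
    (∀ h, i (D'.edge h) = D.edge (i h)) ∧
    (∀ h, i (D'.rot h) = if i h = x ∨ i h = y then i h else D.rot (i h)) ∧
    ∀ h, i (D'.wilson h) =
      if i h = x then y
      else if i h = y then (if D.wilson l = l then x else D.wilson l)
      else if D.wilson (i h) = l then x
      else D.wilson (i h)

/-- The three diagrams of the three-term relation `D_Y = D_∥ - D_X`.  At the trivalent vertex next
to the leg `l` let the half-edges be, in cyclic (counterclockwise) order, the stem `D.edge l`, then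
`b`, then `c`.  In `D_∥` the strands end on the (counterclockwise) Wilson line
uncrossed, that is in the order `c`, `b`; in `D_X` they cross and end in the order `b`, `c`. -/
def IsSTU (DY DP DX : FeynmanDiagram n) : Prop :=
  ∃ l : DY.HalfEdge, DY.IsLeg l ∧ ¬ DY.IsLeg (DY.edge l) ∧
    IsResolution DY DP l (DY.rot (DY.rot (DY.edge l))) (DY.rot (DY.edge l)) ∧
    IsResolution DY DX l (DY.rot (DY.edge l)) (DY.rot (DY.rot (DY.edge l)))

open Classical in
/-- The value of the Alexander-Conway weight system on a chord diagram.

The chord diagram of a singular knot has one chord for each double point.  By the skein relation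
`∇(L₊) - ∇(L₋) = z ∇(L₀)` the alternating sum of `∇` over all resolutions of the `n` double points is
`z ^ n` times `∇` of the link obtained by smoothing all of them, and the constant term of `∇` of a
link is `1` for a knot and `0` if there are several components.  So the weight system of the
coefficient of `z ^ n` has value `1` if smoothing the Wilson line at all chords yields one single
closed curve, and `0` otherwise.  The smoothed curve arrives at a chord end `h`, switches to the other
end `edge h` and goes on along the Wilson line to the chord end `wilson (edge h)`; its closed
components are the cycles of this permutation (one circle if there are no chords). -/
noncomputable def conway (F : FeynmanDiagram n) : ℤ :=
  if ∀ h h' : F.HalfEdge, (F.wilson * F.edge).SameCycle h h' then 1 else 0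

end FeynmanDiagram

section Space

variable (k : Type*) [Field k] (n : ℕ)

/-- The relations between Feynman diagrams: isomorphic diagrams are equal, and the three-term
relation `D_Y - D_∥ + D_X = 0`. -/
noncomputable def relations : Submodule k (FeynmanDiagram n →₀ k) :=
  Submodule.span k
    ({r | ∃ F G : FeynmanDiagram n, F.Iso G ∧ r = Finsupp.single F 1 - Finsupp.single G 1} ∪
     {r | ∃ DY DP DX : FeynmanDiagram n, FeynmanDiagram.IsSTU DY DP DX ∧
        r = Finsupp.single DY 1 - Finsupp.single DP 1 + Finsupp.single DX 1})

/-- The space `𝒜_n` spanned by the Feynman diagrams of order `n` modulo the three-term relations. -/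
abbrev DiagramSpace : Type _ := (FeynmanDiagram n →₀ k) ⧸ relations k n

variable {n} in
/-- The class of a Feynman diagram in `𝒜_n`. -/
noncomputable def cls (F : FeynmanDiagram n) : DiagramSpace k n :=
  (relations k n).mkQ (Finsupp.single F 1)

/-- The subspace `𝒜_n^{(ℓ)}` spanned by the Feynman diagrams with at most `ℓ` legs. -/
noncomputable def legFiltration (l : ℕ) : Submodule k (DiagramSpace k n) :=
  Submodule.span k {a | ∃ F : FeynmanDiagram n, F.numLegs ≤ l ∧ a = cls k F}

variable {k n} in
/-- The Alexander-Conway weight system of order `n`, as a linear functional on `𝒜_n`: it has the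
prescribed values on chord diagrams (and satisfies `C(D_Y) = C(D_∥) - C(D_X)`, being defined on the
quotient space). -/
def IsAlexanderConway (C : DiagramSpace k n →ₗ[k] k) : Prop :=
  ∀ D : FeynmanDiagram n, D.IsChordDiagram → C (cls k D) = (D.conway : k)

end Space

section Wheel

/-- The four half-edges at a spoke of a wheel: the outer end (the leg) and the inner end of the
spoke, and the forward and backward half-edges of the rim at the inner end. -/
inductive WheelEnd
  | outer
  | inner
  | fwd
  | bwd
  deriving DecidableEq

instance : Fintype WheelEnd :=
  ⟨{.outer, .inner, .fwd, .bwd}, by rintro (_ | _ | _ | _) <;> simp⟩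

/-- The edges of the `n`-spoke wheel: the `i`-th spoke joins its outer end with its inner end, and the
rim joins the inner ends of the spokes `i` and `i + 1` (cyclically). -/
def wheelEdge (n : ℕ) : Equiv.Perm (Fin n × WheelEnd) where
  toFun
    | (i, .outer) => (i, .inner)
    | (i, .inner) => (i, .outer)
    | (i, .fwd) => (finRotate n i, .bwd)
    | (i, .bwd) => ((finRotate n).symm i, .fwd)
  invFun
    | (i, .outer) => (i, .inner)
    | (i, .inner) => (i, .outer)
    | (i, .fwd) => (finRotate n i, .bwd)
    | (i, .bwd) => ((finRotate n).symm i, .fwd)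
  left_inv := by
    rintro ⟨i, _ | _ | _ | _⟩ <;>
      simp only [Equiv.symm_apply_apply, Equiv.apply_symm_apply]
  right_inv := by
    rintro ⟨i, _ | _ | _ | _⟩ <;>
      simp only [Equiv.symm_apply_apply, Equiv.apply_symm_apply]

/-- The vertices of the wheel with their orientations, counterclockwise in the plane, where the
spokes are numbered counterclockwise: spoke, forward, backward at each inner vertex. -/
def wheelRot (n : ℕ) : Equiv.Perm (Fin n × WheelEnd) where
  toFun
    | (i, .outer) => (i, .outer)
    | (i, .inner) => (i, .fwd)
    | (i, .fwd) => (i, .bwd)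
    | (i, .bwd) => (i, .inner)
  invFun
    | (i, .outer) => (i, .outer)
    | (i, .inner) => (i, .bwd)
    | (i, .fwd) => (i, .inner)
    | (i, .bwd) => (i, .fwd)
  left_inv := by
    rintro ⟨i, _ | _ | _ | _⟩ <;>
      simp only [Equiv.symm_apply_apply, Equiv.apply_symm_apply]
  right_inv := by
    rintro ⟨i, _ | _ | _ | _⟩ <;>
      simp only [Equiv.symm_apply_apply, Equiv.apply_symm_apply]

/-- The legs of the wheel follow each other in the order of the spokes. -/
def wheelWilson (n : ℕ) : Equiv.Perm (Fin n × WheelEnd) where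
  toFun
    | (i, .outer) => (finRotate n i, .outer)
    | (i, .inner) => (i, .inner)
    | (i, .fwd) => (i, .fwd)
    | (i, .bwd) => (i, .bwd)
  invFun
    | (i, .outer) => ((finRotate n).symm i, .outer)
    | (i, .inner) => (i, .inner)
    | (i, .fwd) => (i, .fwd)
    | (i, .bwd) => (i, .bwd)
  left_inv := by
    rintro ⟨i, _ | _ | _ | _⟩ <;>
      simp only [Equiv.symm_apply_apply, Equiv.apply_symm_apply]
  right_inv := by
    rintro ⟨i, _ | _ | _ | _⟩ <;>
      simp only [Equiv.symm_apply_apply, Equiv.apply_symm_apply]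

theorem wheel_card_vertices (n : ℕ) :
    Nat.card (Quotient (Equiv.Perm.SameCycle.setoid (wheelRot n))) = 2 * n := by
  let c : Fin n × WheelEnd → Fin n × Bool := fun p => (p.1, decide (p.2 = WheelEnd.outer))
  have hc1 : ∀ p, c (wheelRot n p) = c p := by
    rintro ⟨i, _ | _ | _ | _⟩ <;> simp [c, wheelRot]
  have hc : ∀ p q, (wheelRot n).SameCycle p q → c p = c q := by
    rintro p q ⟨m, rfl⟩
    have : ∀ m : ℤ, ∀ p, c ((wheelRot n ^ m) p) = c p := by
      intro m
      induction m with
      | zero => simp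
      | succ m ih => intro p; rw [zpow_add_one, Equiv.Perm.mul_apply, ih, hc1]
      | pred m ih =>
        intro p
        rw [zpow_sub_one, Equiv.Perm.mul_apply, ih, ← hc1]
        simp
    exact (this m p).symm
  let f : Quotient (Equiv.Perm.SameCycle.setoid (wheelRot n)) → Fin n × Bool :=
    Quotient.lift c hc
  have h1 : ∀ i : Fin n, (wheelRot n).SameCycle (i, .inner) (i, .fwd) := fun i => ⟨1, rfl⟩
  have h2 : ∀ i : Fin n, (wheelRot n).SameCycle (i, .inner) (i, .bwd) := fun i => ⟨2, rfl⟩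
  have hf : Function.Bijective f := by
    constructor
    · intro a b
      refine Quotient.inductionOn₂ a b ?_
      rintro ⟨i, s⟩ ⟨j, t⟩ h
      have h' : c (i, s) = c (j, t) := h
      simp only [c, Prod.mk.injEq] at h'
      obtain ⟨rfl, h'⟩ := h'
      apply Quotient.sound
      change (wheelRot n).SameCycle (i, s) (i, t)
      have hh : ∀ s : WheelEnd, s ≠ .outer → (wheelRot n).SameCycle (i, .inner) (i, s) := by
        rintro (_ | _ | _ | _) hs
        · exact absurd rfl hs
        · exact Equiv.Perm.SameCycle.refl _ _
        · exact h1 i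
        · exact h2 i
      by_cases hs : s = .outer
      · have ht : t = .outer := by simpa [hs] using h'
        rw [hs, ht]
      · have ht : t ≠ .outer := by simpa [hs] using h'
        exact (hh s hs).symm.trans (hh t ht)
    · rintro ⟨i, _ | _⟩
      · exact ⟨Quotient.mk _ (i, .inner), by simp [f, c]⟩
      · exact ⟨Quotient.mk _ (i, .outer), by simp [f, c]⟩
  rw [Nat.card_eq_of_bijective f hf]
  simp [mul_comm]

theorem wheelWilson_cycle (n : ℕ) (i j : Fin n) :
    (wheelWilson n).SameCycle (i, .outer) (j, .outer) := by
  have key : ∀ (m : ℕ) (i : Fin n),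
      (wheelWilson n ^ m) (i, .outer) = ((finRotate n ^ m) i, .outer) := by
    intro m
    induction m with
    | zero => simp
    | succ m ih =>
      intro i
      rw [pow_succ, Equiv.Perm.mul_apply, pow_succ, Equiv.Perm.mul_apply, ← ih]
      rfl
  obtain _ | n := n
  · exact i.elim0
  · have h0 : ∀ i : Fin (n + 1), (wheelWilson (n + 1)).SameCycle (0, .outer) (i, .outer) := by
      intro i
      refine ⟨(i : ℕ), ?_⟩
      rw [zpow_natCast, key]
      have : ∀ m : ℕ, (h : m < n + 1) → (finRotate (n + 1) ^ m) 0 = ⟨m, h⟩ := by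
        intro m
        induction m with
        | zero => intro h; rfl
        | succ m ih =>
          intro h
          rw [pow_succ', Equiv.Perm.mul_apply, ih (by omega)]
          exact finRotate_of_lt (by omega)
      rw [this i i.2]
    exact (h0 i).symm.trans (h0 j)

/-- The wheel `w_n` with `n` spokes. -/
def wheel (n : ℕ) : FeynmanDiagram n where
  HalfEdge := Fin n × WheelEnd
  finite := inferInstance
  edge := wheelEdge n
  edge_edge := by
    rintro ⟨i, _ | _ | _ | _⟩ <;>
      simp only [wheelEdge, Equiv.coe_fn_mk, Equiv.symm_apply_apply, Equiv.apply_symm_apply]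
  edge_ne := by rintro ⟨i, _ | _ | _ | _⟩ <;> simp [wheelEdge]
  rot := wheelRot n
  rot_rot_rot := by rintro ⟨i, _ | _ | _ | _⟩ <;> simp [wheelRot]
  card_vertices := wheel_card_vertices n
  wilson := wheelWilson n
  wilson_of_not_leg := by rintro ⟨i, _ | _ | _ | _⟩ <;> simp [wheelRot, wheelWilson]
  wilson_cycle := by
    rintro ⟨i, _ | _ | _ | _⟩ ⟨j, _ | _ | _ | _⟩ hi hj <;>
      first
        | exact wheelWilson_cycle n i j
        | (exfalso; revert hi; simp [wheelRot]; done)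
        | (exfalso; revert hj; simp [wheelRot])
  exists_leg := by
    rintro ⟨i, s⟩
    refine ⟨(i, .outer), rfl, ?_⟩
    have h1 : Relation.ReflTransGen (fun x y => y = wheelEdge n x ∨ y = wheelRot n x)
        (i, WheelEnd.inner) (i, .outer) := .single (Or.inl rfl)
    have h2 := Relation.ReflTransGen.head
      (r := fun x y => y = wheelEdge n x ∨ y = wheelRot n x)
      (a := (i, WheelEnd.bwd)) (Or.inr rfl) h1
    have h3 := Relation.ReflTransGen.head
      (r := fun x y => y = wheelEdge n x ∨ y = wheelRot n x)
      (a := (i, WheelEnd.fwd)) (Or.inr rfl) h2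
    rcases s with _ | _ | _ | _
    · exact .refl
    · exact h1
    · exact h3
    · exact h2

end Wheel

end AlexanderConway

/-! The functional is a state sum. Reading `D_Y = D_∥ - D_X` at a trivalent vertex as a difference
of its two cyclic orderings, a state chooses an ordering at every trivalent vertex. It has sign `-1`
for each given ordering kept, and it counts `1` if the boundary curves of the resulting ribbon
graph, joined along the Wilson line, form a single curve. On chord diagrams this is the prescribed
value. Fixing the ordering next to a leg gives the state sum of one of the two resolutions
(`sum_state_of_isResolution`), so the sum satisfies the three-term relation. Uniqueness holds
because a diagram that is not a chord diagram has a leg next to a trivalent vertex, and resolving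
there removes two half-edges.

Vanishing: for a permutation matrix `P`, the determinant of `1 - P` with one row replaced by its
basis vector is `1` if the permutation is transitive and `0` otherwise. Reversing a vertex changes
three rows, and multilinearity writes the change as a sum of terms, each with one of the three edges
replaced by a row symmetric in its two ends (`det_vertex_sub`). Such a term does not see the
ordering at the far end of that edge if a trivalent vertex is there (`vertexDet_cycleRows_toggle`),
while the sign does; so it cancels in the sum. Hence the weight is zero as soon as some trivalent
vertex has no leg as a neighbour (`weight_eq_zero_of_neighbors`). With fewer than `n` legs there are
more trivalent vertices than legs, so such a vertex exists.

Wheel: a state has a single curve exactly when the set of reversed spokes is nonempty and lies in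
one class of an alternating 2-colouring of the rim. For odd `n` there is no such colouring. For even
`n` the signed sum over all subsets of one class is zero, so leaving out the empty subset gives `-1`
for each of the two classes. -/

namespace AlexanderConway

/-! ### Comparing the cycles of permutations -/

section Cycles

open Equiv.Perm

/-- A permutation is transitive if it has a single cycle, fixed points being counted as cycles. -/
def IsTransitive {H : Type*} (π : Equiv.Perm H) : Prop := ∀ x y, π.SameCycle x y

theorem sameCycle_map {H H' : Type*} {π : Equiv.Perm H} {π' : Equiv.Perm H'} (f : H → H')
    (hf : ∀ x, π'.SameCycle (f x) (f (π x))) {x y : H} (h : π.SameCycle x y) :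
    π'.SameCycle (f x) (f y) := by
  obtain ⟨m, rfl⟩ := h
  induction m with
  | zero => exact SameCycle.refl _ _
  | succ m ih =>
    rw [add_comm, zpow_add, zpow_one, Equiv.Perm.mul_apply]
    exact ih.trans (hf _)
  | pred m ih =>
    refine ih.trans ?_
    have := hf ((π ^ (-(m : ℤ) - 1)) x)
    rw [← Equiv.Perm.mul_apply, ← zpow_one_add, add_sub_cancel] at this
    exact this.symm

/-- `i` and `r` induce mutually inverse maps between the sets of cycles. They need not be
bijections, so points may be contracted along a cycle. -/
theorem isTransitive_congr {H H' : Type*} {π : Equiv.Perm H} {π' : Equiv.Perm H'}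
    (i : H' → H) (r : H → H') (hri : ∀ h, r (i h) = h)
    (hi : ∀ h, π.SameCycle (i h) (i (π' h))) (hr : ∀ x, π'.SameCycle (r x) (r (π x)))
    (hir : ∀ x, π.SameCycle x (i (r x))) : IsTransitive π ↔ IsTransitive π' := by
  constructor
  · intro h x y
    rw [← hri x, ← hri y]
    exact sameCycle_map r hr (h _ _)
  · intro h x y
    exact (hir x).trans ((sameCycle_map i hi (h (r x) (r y))).trans (hir y).symm)

theorem not_isTransitive_of_invariant {H : Type*} {π : Equiv.Perm H} (P : H → Prop)
    (hP : ∀ x, P x → P (π x)) (hP' : ∀ x, P (π x) → P x) {a b : H} (ha : P a) (hb : ¬ P b) :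
    ¬ IsTransitive π := by
  intro h
  obtain ⟨m, hm⟩ := h a b
  have : ∀ m : ℤ, P ((π ^ m) a) := by
    intro m
    induction m with
    | zero => exact ha
    | succ m ih =>
      rw [add_comm, zpow_add, zpow_one, Equiv.Perm.mul_apply]
      exact hP _ ih
    | pred m ih =>
      apply hP'
      rw [← Equiv.Perm.mul_apply, ← zpow_one_add, add_sub_cancel]
      exact ih
  exact hb (hm ▸ this m)

end Cycles

/-! ### The state sum -/

namespace FeynmanDiagram

variable {n : ℕ}

instance finite_halfEdge (F : FeynmanDiagram n) : Finite F.HalfEdge := F.finite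

noncomputable instance fintypeHalfEdge (F : FeynmanDiagram n) : Fintype F.HalfEdge :=
  Fintype.ofFinite _

/-- A choice of one of the two cyclic orderings at each trivalent vertex. -/
structure State (F : FeynmanDiagram n) where
  val : F.HalfEdge → Bool
  val_rot : ∀ h, val (F.rot h) = val h
  -- There is nothing to choose at a leg; fixing the value keeps the state sum from counting a
  -- choice there.
  val_of_isLeg : ∀ h, F.IsLeg h → val h = false

theorem State.val_injective {F : FeynmanDiagram n} : Function.Injective (State.val (F := F)) := by
  rintro ⟨_, _, _⟩ ⟨_, _, _⟩ rfl
  rfl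

instance finite_state (F : FeynmanDiagram n) : Finite F.State :=
  Finite.of_injective _ State.val_injective

noncomputable instance fintypeState (F : FeynmanDiagram n) : Fintype F.State :=
  Fintype.ofFinite _

theorem rot_symm (F : FeynmanDiagram n) (h : F.HalfEdge) : F.rot.symm h = F.rot (F.rot h) := by
  rw [Equiv.symm_apply_eq, F.rot_rot_rot]

theorem edge_symm (F : FeynmanDiagram n) (h : F.HalfEdge) : F.edge.symm h = F.edge h := by
  rw [Equiv.symm_apply_eq, F.edge_edge]

variable {F : FeynmanDiagram n}

theorem IsLeg.rot_iff {h : F.HalfEdge} : F.IsLeg (F.rot h) ↔ F.IsLeg h := by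
  simp [IsLeg]

theorem wilson_of_not_isLeg {h : F.HalfEdge} (hh : ¬ F.IsLeg h) : F.wilson h = h :=
  F.wilson_of_not_leg h hh

theorem isLeg_wilson_iff {h : F.HalfEdge} : F.IsLeg (F.wilson h) ↔ F.IsLeg h := by
  by_cases hh : F.IsLeg h
  · refine iff_of_true ?_ hh
    by_contra h'
    have := wilson_of_not_isLeg h'
    rw [EmbeddingLike.apply_eq_iff_eq] at this
    exact h' (by rw [this]; exact hh)
  · rw [wilson_of_not_isLeg hh]

namespace State

theorem ext {ε η : F.State} (h : ∀ x, ε.1 x = η.1 x) : ε = η := val_injective (funext h)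

theorem rot_apply (ε : F.State) (h : F.HalfEdge) : ε.1 (F.rot h) = ε.1 h := ε.val_rot h

theorem of_isLeg (ε : F.State) {h : F.HalfEdge} (hh : F.IsLeg h) : ε.1 h = false :=
  ε.val_of_isLeg h hh

theorem rot_symm_apply (ε : F.State) (h : F.HalfEdge) : ε.1 (F.rot.symm h) = ε.1 h := by
  rw [rot_symm, rot_apply, rot_apply]

/-- The vertices of `F` with the cyclic orderings of the state. -/
def vertexPerm (ε : F.State) : Equiv.Perm F.HalfEdge where
  toFun h := if ε.1 h then F.rot h else F.rot.symm h
  invFun h := if ε.1 h then F.rot.symm h else F.rot h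
  left_inv h := by
    cases hh : ε.1 h <;> simp [hh, rot_apply, rot_symm_apply]
  right_inv h := by
    cases hh : ε.1 h <;> simp [hh, rot_apply, rot_symm_apply]

theorem vertexPerm_apply (ε : F.State) (h : F.HalfEdge) :
    ε.vertexPerm h = if ε.1 h then F.rot h else F.rot.symm h := rfl

theorem vertexPerm_of_isLeg (ε : F.State) {h : F.HalfEdge} (hh : F.IsLeg h) :
    ε.vertexPerm h = h := by
  have h' : F.rot h = h := hh
  simp [vertexPerm_apply, of_isLeg ε hh, rot_symm, h']

theorem isLeg_vertexPerm_iff (ε : F.State) {h : F.HalfEdge} :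
    F.IsLeg (ε.vertexPerm h) ↔ F.IsLeg h := by
  rw [vertexPerm_apply]
  split
  · exact IsLeg.rot_iff
  · rw [rot_symm, IsLeg.rot_iff, IsLeg.rot_iff]

/-- The boundary curves of the thickened graph, glued to the Wilson line. -/
def facePerm (ε : F.State) : Equiv.Perm F.HalfEdge := F.wilson * ε.vertexPerm * F.edge

theorem facePerm_apply (ε : F.State) (h : F.HalfEdge) :
    ε.facePerm h = F.wilson (ε.vertexPerm (F.edge h)) := rfl

theorem facePerm_edge_of_isLeg (ε : F.State) {h : F.HalfEdge} (hh : F.IsLeg h) :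
    ε.facePerm (F.edge h) = F.wilson h := by
  rw [facePerm_apply, F.edge_edge, vertexPerm_of_isLeg ε hh]

theorem facePerm_edge_of_not_isLeg (ε : F.State) {h : F.HalfEdge} (hh : ¬ F.IsLeg h) :
    ε.facePerm (F.edge h) = ε.vertexPerm h := by
  rw [facePerm_apply, F.edge_edge, wilson_of_not_isLeg (mt ε.isLeg_vertexPerm_iff.1 hh)]

/-- The sign of a state: `-1` for each trivalent vertex with its given cyclic ordering. -/
noncomputable def sign (ε : F.State) : ℤ := ∏ h, if ε.1 h then -1 else 1

open Classical in
/-- Whether there is a single boundary curve. -/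
noncomputable def single (ε : F.State) : ℤ := if IsTransitive ε.facePerm then 1 else 0

end State

/-- The Alexander-Conway weight system as a state sum. -/
noncomputable def weight (F : FeynmanDiagram n) : ℤ := ∑ ε : F.State, ε.sign * ε.single

theorem weight_eq_of_iso {F G : FeynmanDiagram n} (h : F.Iso G) : F.weight = G.weight := by
  obtain ⟨e, he, hr, hw⟩ := h
  have hr' : ∀ h, e.symm (G.rot h) = F.rot (e.symm h) := fun h => by
    rw [Equiv.symm_apply_eq, hr, e.apply_symm_apply]
  have hleg : ∀ h, F.IsLeg h ↔ G.IsLeg (e h) := fun h => by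
    unfold IsLeg; rw [← hr, e.apply_eq_iff_eq]
  have hleg' : ∀ h, G.IsLeg h ↔ F.IsLeg (e.symm h) := fun h => by
    rw [hleg, e.apply_symm_apply]
  let f : F.State ≃ G.State :=
    { toFun := fun ε => ⟨ε.1 ∘ e.symm, fun h => by
          simp [hr', State.rot_apply], fun h hh => ε.of_isLeg ((hleg' h).1 hh)⟩
      invFun := fun ε => ⟨ε.1 ∘ e, fun h => by
          simp [hr, State.rot_apply], fun h hh => ε.of_isLeg ((hleg h).1 hh)⟩
      left_inv := fun ε => State.ext fun h => by simp
      right_inv := fun ε => State.ext fun h => by simp }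
  have hf : ∀ ε h, (f ε).1 (e h) = ε.1 h := fun ε h => by
    change ε.1 (e.symm (e h)) = ε.1 h
    rw [e.symm_apply_apply]
  refine Fintype.sum_equiv f _ _ fun ε => ?_
  congr 1
  · exact Fintype.prod_equiv e _ _ fun h => by rw [hf]
  · have hface : ∀ h, e (ε.facePerm h) = (f ε).facePerm (e h) := fun h => by
      rw [State.facePerm_apply, State.facePerm_apply, hw, State.vertexPerm_apply,
        State.vertexPerm_apply, ← he, hf, rot_symm, rot_symm]
      congr 1
      split <;> simp [hr]
    unfold State.single
    have : IsTransitive ε.facePerm ↔ IsTransitive (f ε).facePerm := by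
      refine isTransitive_congr e.symm e (fun h => by simp) (fun h => ?_) (fun x => ?_)
        fun x => ?_
      · have : e.symm ((f ε).facePerm h) = ε.facePerm (e.symm h) := by
          rw [Equiv.symm_apply_eq, hface, e.apply_symm_apply]
        rw [this]
        exact ⟨1, rfl⟩
      · rw [hface]; exact ⟨1, rfl⟩
      · rw [e.symm_apply_apply]
    classical exact if_congr this rfl rfl

/-- Without trivalent vertices there is one state, of sign `1`, and its boundary permutation is the
one that smooths all chords. -/
theorem weight_of_isChordDiagram {D : FeynmanDiagram n} (hD : D.IsChordDiagram) :
    D.weight = D.conway := by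
  let ε₀ : D.State := ⟨fun _ => false, fun _ => rfl, fun _ _ => rfl⟩
  have h0 : ∀ ε : D.State, ε = ε₀ := fun ε => State.ext fun h => ε.of_isLeg (hD h)
  have hu : (Finset.univ : Finset D.State) = {ε₀} := by
    ext ε; simp [h0 ε]
  rw [weight, hu, Finset.sum_singleton]
  have hs : ε₀.sign = 1 := by simp [State.sign, ε₀]
  have hf : ε₀.facePerm = D.wilson * D.edge := by
    ext h
    rw [State.facePerm_apply, State.vertexPerm_of_isLeg _ (hD _)]
    rfl
  rw [hs, one_mul, State.single, hf]
  rfl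

/-! ### The state sum satisfies the three-term relation -/

section Resolution

variable {D D' : FeynmanDiagram n} {l x y : D.HalfEdge}

open Classical in
/-- The part of the state sum with the vertex next to the leg `l` in the cyclic ordering
`D.edge l`, `x`, `y`. -/
theorem sum_state_of_isResolution (o : Bool) (hl : D.IsLeg l) (hs : ¬ D.IsLeg (D.edge l))
    (hx : (if o then D.rot (D.edge l) else D.rot.symm (D.edge l)) = x)
    (hy : (if o then D.rot x else D.rot.symm x) = y)
    (h : IsResolution D D' l x y) :
    ∑ ε : D.State with ε.1 (D.edge l) = o, ε.sign * ε.single =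
      (if o then -1 else 1) * D'.weight := by
  obtain ⟨i, hi, hrange, hedge, hrot, hwil⟩ := h
  obtain ⟨s, hse⟩ : ∃ s, s = D.edge l := ⟨_, rfl⟩
  rw [← hse] at hs hx hrange ⊢
  have hes : D.edge s = l := by rw [hse, D.edge_edge]
  have hcyc : (D.rot s = x ∧ D.rot x = y ∧ D.rot y = s) ∨
      (D.rot s = y ∧ D.rot y = x ∧ D.rot x = s) := by
    cases o
    · simp only [Bool.false_eq_true, if_false, rot_symm] at hx hy
      subst hy; subst hx
      simp [D.rot_rot_rot]
    · simp only [if_true] at hx hy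
      subst hy; subst hx
      simp [D.rot_rot_rot]
  have hxs : x ≠ s := by
    rintro rfl
    rcases hcyc with h | h
    · exact hs h.1
    · exact hs h.2.2
  have hys : y ≠ s := by
    rintro rfl
    rcases hcyc with h | h
    · exact hs h.2.2
    · exact hs h.1
  have hxy : x ≠ y := by
    rintro rfl
    rcases hcyc with h | h
    · exact hxs (D.rot.injective (h.2.1.trans h.1.symm))
    · exact hxs (h.2.1.symm.trans h.2.2)
  have hxl' : ¬ D.IsLeg x := by
    rcases hcyc with h | h
    · exact fun h' => hxy (h'.symm.trans h.2.1)
    · exact fun h' => hxs (h'.symm.trans h.2.2)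
  have hyl' : ¬ D.IsLeg y := by
    rcases hcyc with h | h
    · exact fun h' => hys (h'.symm.trans h.2.2)
    · exact fun h' => hxy (h.2.1.symm.trans h')
  have hxl : x ≠ l := fun h => hxl' (h ▸ hl)
  have hyl : y ≠ l := fun h => hyl' (h ▸ hl)
  have hsl : s ≠ l := fun h => hs (h ▸ hl)
  have hv : ∀ h, (D.rot h = s ∨ D.rot h = x ∨ D.rot h = y) ↔ (h = s ∨ h = x ∨ h = y) := by
    intro h
    constructor
    · rcases hcyc with ⟨h1, h2, h3⟩ | ⟨h1, h2, h3⟩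
      · rintro (h' | h' | h')
        · exact Or.inr (Or.inr (D.rot.injective (h'.trans h3.symm)))
        · exact Or.inl (D.rot.injective (h'.trans h1.symm))
        · exact Or.inr (Or.inl (D.rot.injective (h'.trans h2.symm)))
      · rintro (h' | h' | h')
        · exact Or.inr (Or.inl (D.rot.injective (h'.trans h3.symm)))
        · exact Or.inr (Or.inr (D.rot.injective (h'.trans h2.symm)))
        · exact Or.inl (D.rot.injective (h'.trans h1.symm))
    · rcases hcyc with ⟨h1, h2, h3⟩ | ⟨h1, h2, h3⟩ <;> rintro (rfl | rfl | rfl) <;> tauto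
  have hir : ∀ h, i h ≠ l ∧ i h ≠ s := fun h => by
    have : i h ∈ Set.range i := ⟨h, rfl⟩
    rw [hrange] at this
    simpa using this
  have hex : ∀ h, h ≠ l → h ≠ s → ∃ h', i h' = h := fun h h1 h2 => by
    have : h ∈ Set.range i := by rw [hrange]; simp [h1, h2]
    exact this
  obtain ⟨x', hx'⟩ := hex x hxl hxs
  obtain ⟨y', hy'⟩ := hex y hyl hys
  have hεx : ∀ ε : D.State, ε.1 x = ε.1 s ∧ ε.1 y = ε.1 s := by
    intro ε
    rcases hcyc with ⟨h1, h2, h3⟩ | ⟨h1, h2, h3⟩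
    · rw [← h2, ε.rot_apply, ← h1, ε.rot_apply]; simp
    · rw [← h2, ε.rot_apply, ← h1, ε.rot_apply]; simp
  have hleg' : ∀ h, D'.IsLeg h ↔ (i h = x ∨ i h = y) ∨ D.IsLeg (i h) := by
    intro h
    unfold IsLeg
    rw [← hi.eq_iff, hrot]
    split <;> simp_all
  -- Outside the range of `i` there are only `l` and `s`. At `s` the value is `o`, so the default
  -- `false` is used at `l` alone, where it is forced.
  let ext : D'.State → D.State := fun ε' =>
    ⟨fun h => if h = s ∨ h = x ∨ h = y then o else Function.extend i ε'.1 (fun _ => false) h, by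
      intro h
      rw [if_congr (hv h) rfl rfl]
      split_ifs with h1
      · rfl
      · push Not at h1
        by_cases h2 : h = l
        · rw [h2, show D.rot l = l from hl]
        · obtain ⟨h', rfl⟩ := hex h h2 h1.1
          have : D.rot (i h') = i (D'.rot h') := by rw [hrot, if_neg]; tauto
          rw [this, hi.extend_apply, hi.extend_apply, ε'.rot_apply], by
      intro h hh
      rw [if_neg]
      · by_cases h2 : h = l
        · rw [Function.extend_apply']
          rintro ⟨a, ha⟩
          exact (hir a).1 (ha.trans h2)
        · obtain ⟨h', rfl⟩ := hex h h2 (by rintro rfl; exact hs hh)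
          rw [hi.extend_apply]
          exact ε'.of_isLeg ((hleg' h').2 (Or.inr hh))
      · rintro (rfl | rfl | rfl)
        · exact hs hh
        · exact hxl' hh
        · exact hyl' hh⟩
  -- The ends `x` and `y` have become legs, so their value must be reset to `false`.
  let res : D.State → D'.State := fun ε =>
    ⟨fun h => if i h = x ∨ i h = y then false else ε.1 (i h), by
      intro h
      simp only [hrot]
      by_cases h1 : i h = x ∨ i h = y
      · simp only [if_pos h1]
      · simp only [if_neg h1]
        rw [if_neg, ε.rot_apply]
        intro h2
        rcases (hv (i h)).1 (Or.inr h2) with h3 | h3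
        · exact (hir h).2 h3
        · exact h1 h3, by
      intro h hh
      split_ifs with h1
      · rfl
      · exact ε.of_isLeg (((hleg' h).1 hh).resolve_left h1)⟩
  have hexts : ∀ ε', (ext ε').1 s = o := fun ε' => by simp [ext]
  have hexti : ∀ ε' h, i h ≠ x → i h ≠ y → (ext ε').1 (i h) = ε'.1 h := fun ε' h h1 h2 => by
    simp [ext, h1, h2, (hir h).2, hi.extend_apply]
  have hextl : ∀ ε', (ext ε').1 l = false := fun ε' => State.of_isLeg _ hl
  rw [weight, Finset.mul_sum]
  symm
  refine Finset.sum_bij' (fun ε' _ => ext ε') (fun ε _ => res ε) (fun ε' _ => by simp [hexts])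
    (fun ε _ => Finset.mem_univ _) (fun ε' _ => ?_) (fun ε hε => ?_) (fun ε' _ => ?_)
  · refine State.ext fun h => ?_
    change (if i h = x ∨ i h = y then false else (ext ε').1 (i h)) = ε'.1 h
    split_ifs with h1
    · exact (ε'.of_isLeg ((hleg' h).2 (Or.inl h1))).symm
    · push Not at h1
      exact hexti _ _ h1.1 h1.2
  · have hε' : ε.1 s = o := by simpa using hε
    refine State.ext fun h => ?_
    by_cases h1 : h = s ∨ h = x ∨ h = y
    · have : (ext (res ε)).1 h = o := by simp only [ext, if_pos h1]
      rw [this]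
      rcases h1 with rfl | rfl | rfl
      · exact hε'.symm
      · rw [(hεx ε).1, hε']
      · rw [(hεx ε).2, hε']
    · push Not at h1
      by_cases h2 : h = l
      · rw [h2, hextl, ε.of_isLeg hl]
      · obtain ⟨h', rfl⟩ := hex h h2 h1.1
        rw [hexti _ _ h1.2.1 h1.2.2]
        simp [res, h1.2.1, h1.2.2]
  · generalize hε : ext ε' = ε
    have h0 : ε.1 s = o := hε ▸ hexts ε'
    have hτs : ε.vertexPerm s = x := by
      rw [State.vertexPerm_apply, h0]; exact hx
    have hτx : ε.vertexPerm x = y := by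
      rw [State.vertexPerm_apply, (hεx ε).1, h0]; exact hy
    have hτy : ε.vertexPerm y = s := by
      rw [State.vertexPerm_apply, (hεx ε).2, h0]
      cases o
      · simp only [Bool.false_eq_true, if_false, rot_symm] at hx hy ⊢
        rw [← hy, ← hx]; simp [D.rot_rot_rot]
      · simp only [if_true] at hx hy ⊢
        rw [← hy, ← hx]; simp [D.rot_rot_rot]
    have hεi : ∀ h, i h ≠ x → i h ≠ y → ε.1 (i h) = ε'.1 h := hε ▸ hexti ε'
    have hε'x : ∀ h, i h = x ∨ i h = y → ε'.1 h = false := fun h hh =>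
      ε'.of_isLeg ((hleg' h).2 (Or.inl hh))
    -- The stem supplies the factor for `o`. The half-edges `x` and `y` lose one such factor each,
    -- and these two cancel.
    have hsign : ε.sign = (if o then -1 else 1) * ε'.sign := by
      have huniv : (Finset.univ : Finset D.HalfEdge) =
          insert l (insert s (Finset.univ.image i)) := by
        ext h
        by_cases h1 : h = l
        · simp [h1]
        by_cases h2 : h = s
        · simp [h2]
        obtain ⟨h', rfl⟩ := hex h h1 h2
        simp
      rw [State.sign, huniv, Finset.prod_insert, Finset.prod_insert, Finset.prod_image
        (fun a _ b _ h => hi h), ε.of_isLeg hl, h0, State.sign]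
      · simp only [Bool.false_eq_true, if_false, one_mul]
        congr 1
        have : ∀ h, (if ε.1 (i h) then (-1 : ℤ) else 1) = (if ε'.1 h then -1 else 1) *
            ((if h = x' then (if o then -1 else 1) else 1) *
              (if h = y' then (if o then -1 else 1) else 1)) := by
          intro h
          by_cases h1 : h = x'
          · have h2 : h ≠ y' := by rintro rfl; exact hxy (by rw [← hx', ← hy', h1])
            rw [if_pos h1, if_neg h2, h1, hx', (hεx ε).1, h0, hε'x x' (Or.inl hx')]
            simp
          · by_cases h2 : h = y'
            · rw [if_neg h1, if_pos h2, h2, hy', (hεx ε).2, h0, hε'x y' (Or.inr hy')]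
              simp
            · rw [if_neg h1, if_neg h2, hεi h (fun h3 => h1 (hi (h3.trans hx'.symm)))
                (fun h3 => h2 (hi (h3.trans hy'.symm)))]
              simp
        simp_rw [this, Finset.prod_mul_distrib, Finset.prod_ite_eq' Finset.univ]
        cases o <;> simp
      · simp only [Finset.mem_image, Finset.mem_univ, true_and, not_exists]
        exact fun h => (hir h).2
      · simp only [Finset.mem_insert, Finset.mem_image, Finset.mem_univ, true_and, not_or,
          not_exists]
        exact ⟨hsl.symm, fun h => (hir h).1⟩
    have hsingle : ε.single = ε'.single := by
      refine if_congr ?_ rfl rfl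
      -- The curves of `D` run into `l` and then to `x`, from `edge x` to `y`, and from `edge y`
      -- through `s` to the successor of `l`. Skipping `l` and `s` leaves the curves of `D'`.
      have hπl : ε.facePerm l = x := by
        rw [← hes, State.facePerm_edge_of_not_isLeg _ hs, hτs]
      have hπs : ε.facePerm s = D.wilson l := by
        rw [hse, State.facePerm_edge_of_isLeg _ hl]
      have hπx : ε.facePerm (D.edge x) = y := by
        rw [State.facePerm_edge_of_not_isLeg _ hxl', hτx]
      have hπy : ε.facePerm (D.edge y) = s := by
        rw [State.facePerm_edge_of_not_isLeg _ hyl', hτy]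
      have hx'l : D'.IsLeg x' := (hleg' x').2 (Or.inl (Or.inl hx'))
      have hy'l : D'.IsLeg y' := (hleg' y').2 (Or.inl (Or.inr hy'))
      have hπ'x : ε'.facePerm (D'.edge x') = y' := by
        rw [State.facePerm_edge_of_isLeg _ hx'l, ← hi.eq_iff, hwil, if_pos hx', hy']
      have hπ'y : i (ε'.facePerm (D'.edge y')) = if D.wilson l = l then x else D.wilson l := by
        rw [State.facePerm_edge_of_isLeg _ hy'l, hwil, if_neg (by rw [hy']; exact hxy.symm),
          if_pos hy']
      have hπ' : ∀ h, h ≠ x' → h ≠ y' → ε.facePerm (D.edge (i h)) = l ∧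
          ε'.facePerm (D'.edge h) = x' ∨
          ε.facePerm (D.edge (i h)) = i (ε'.facePerm (D'.edge h)) := by
        intro h h1 h2
        have h1' : i h ≠ x := fun h3 => h1 (hi (h3.trans hx'.symm))
        have h2' : i h ≠ y := fun h3 => h2 (hi (h3.trans hy'.symm))
        by_cases hh : D.IsLeg (i h)
        · rw [State.facePerm_edge_of_isLeg _ hh,
            State.facePerm_edge_of_isLeg _ ((hleg' h).2 (Or.inr hh))]
          by_cases h3 : D.wilson (i h) = l
          · left
            rw [← hi.eq_iff, hwil, if_neg h1', if_neg h2', if_pos h3, hx']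
            exact ⟨h3, rfl⟩
          · right
            rw [hwil, if_neg h1', if_neg h2', if_neg h3]
        · right
          have hh' : ¬ D'.IsLeg h := by rw [hleg']; tauto
          rw [State.facePerm_edge_of_not_isLeg _ hh, State.facePerm_edge_of_not_isLeg _ hh',
            State.vertexPerm_apply, State.vertexPerm_apply, hεi h h1' h2', rot_symm, rot_symm]
          have e1 : i (D'.rot h) = D.rot (i h) := by rw [hrot, if_neg (by tauto)]
          have e2 : i (D'.rot (D'.rot h)) = D.rot (D.rot (i h)) := by
            rw [hrot, e1, if_neg]
            intro h3
            rcases (hv (i h)).1 (Or.inr h3) with h4 | h4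
            · exact (hir h).2 h4
            · tauto
          split
          · exact e1.symm
          · exact e2.symm
      have hexy : ∀ h, i h ≠ D.edge x → h ≠ D'.edge x' := by
        rintro _ h1 rfl
        exact h1 (by rw [hedge, hx'])
      have hstep : ∀ h : D'.HalfEdge, ∃ h', h = D'.edge h' ∧ i h = D.edge (i h') := fun h =>
        ⟨D'.edge h, (D'.edge_edge h).symm, by rw [← hedge, D'.edge_edge]⟩
      have hsc : ∀ {H : Type} {π : Equiv.Perm H} {a b : H}, π a = b → π.SameCycle a b :=
        fun h => ⟨1, h⟩
      have : Nonempty D'.HalfEdge := ⟨x'⟩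
      -- Contract `l` forwards to its successor `x` and `s` backwards to its predecessor `edge y`.
      let r : D.HalfEdge → D'.HalfEdge := fun h =>
        if h = l then x' else if h = s then D'.edge y' else Function.invFun i h
      have hri : ∀ h, r (i h) = h := fun h => by
        simp only [r, if_neg (hir h).1, if_neg (hir h).2]
        exact Function.leftInverse_invFun hi h
      have hrl : r l = x' := if_pos rfl
      have hrs : r s = D'.edge y' := by simp only [r, if_neg hsl, if_true]
      refine isTransitive_congr i r hri (fun h => ?_) (fun h => ?_) (fun h => ?_)
      · obtain ⟨h', rfl, h1⟩ := hstep h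
        rw [h1]
        by_cases h2 : h' = x'
        · rw [h2, hπ'x, hx', hy']; exact hsc hπx
        by_cases h3 : h' = y'
        · rw [h3, hπ'y, hy']
          refine (hsc hπy).trans ((hsc hπs).trans ?_)
          split_ifs with h4
          · rw [h4]; exact hsc hπl
          · exact Equiv.Perm.SameCycle.refl _ _
        rcases hπ' h' h2 h3 with ⟨h4, h5⟩ | h4
        · rw [h5, hx']; exact (hsc h4).trans (hsc hπl)
        · exact hsc h4
      · by_cases hl' : h = l
        · rw [hl', hπl, ← hx', hri, hrl]
        by_cases hs' : h = s
        · rw [hs', hπs, hrs]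
          by_cases h4 : D.wilson l = l
          · rw [h4, hrl]
            rw [if_pos h4, ← hx', hi.eq_iff] at hπ'y
            exact hsc hπ'y
          · rw [if_neg h4] at hπ'y
            rw [← hπ'y, hri]
            exact hsc rfl
        obtain ⟨h, rfl⟩ := hex h hl' hs'
        rw [hri]
        obtain ⟨h', rfl, h1⟩ := hstep h
        rw [h1]
        by_cases h2 : h' = x'
        · rw [h2, hx', hπx, ← hy', hri]; exact hsc hπ'x
        by_cases h3 : h' = y'
        · rw [h3, hy', hπy, hrs]
        rcases hπ' h' h2 h3 with ⟨h4, h5⟩ | h4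
        · rw [h4, hrl]; exact hsc h5
        · rw [h4, hri]; exact hsc rfl
      · by_cases hl' : h = l
        · rw [hl', hrl, hx']; exact hsc hπl
        by_cases hs' : h = s
        · rw [hs', hrs, hedge, hy']; exact (hsc hπy).symm
        obtain ⟨h, rfl⟩ := hex h hl' hs'
        rw [hri]
    rw [hsign, hsingle, mul_assoc]

end Resolution

/-- Split the states by the ordering at the vertex next to the leg: the given one carries `-1` and
yields the crossed resolution, the reversed one yields the parallel resolution. -/
theorem weight_of_isSTU {DY DP DX : FeynmanDiagram n} (h : IsSTU DY DP DX) :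
    DY.weight = DP.weight - DX.weight := by
  obtain ⟨l, hl, hs, hP, hX⟩ := h
  have h1 := sum_state_of_isResolution true hl hs (by simp) (by simp) hX
  have h2 := sum_state_of_isResolution false hl hs (by simp [rot_symm]) (by simp) hP
  have h3 : DY.weight = ∑ ε : DY.State with ε.1 (DY.edge l) = true, ε.sign * ε.single +
      ∑ ε : DY.State with ε.1 (DY.edge l) = false, ε.sign * ε.single := by
    rw [weight, ← Finset.sum_filter_add_sum_filter_not _ (fun ε => ε.1 (DY.edge l) = true)]
    simp
  rw [h3, h1, h2]
  simp
  ring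

end FeynmanDiagram

/-! ### The state sum as a functional on the quotient -/

section Functional

variable (k : Type*) [Field k] (n : ℕ)

/-- The Alexander-Conway weight system. -/
noncomputable def weightFunctional : DiagramSpace k n →ₗ[k] k :=
  (relations k n).liftQ (Finsupp.linearCombination k fun F => (F.weight : k)) <| by
    rw [relations, Submodule.span_le]
    rintro r (⟨F, G, h, rfl⟩ | ⟨DY, DP, DX, h, rfl⟩)
    · simp [FeynmanDiagram.weight_eq_of_iso h]
    · simp [FeynmanDiagram.weight_of_isSTU h]

theorem weightFunctional_cls (F : FeynmanDiagram n) :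
    weightFunctional k n (cls k F) = (F.weight : k) := by
  simp [weightFunctional, cls]

theorem isAlexanderConway_weightFunctional : IsAlexanderConway (weightFunctional k n) :=
  fun D hD => by rw [weightFunctional_cls, FeynmanDiagram.weight_of_isChordDiagram hD]

end Functional

/-! ### Counting vertices by half-edges -/

section Cycles

open Equiv.Perm

theorem sameCycle_iff_of_cube {H : Type*} {r : Equiv.Perm H} (hr : ∀ h, r (r (r h)) = h)
    {a b : H} : r.SameCycle a b ↔ b = a ∨ b = r a ∨ b = r (r a) := by
  constructor
  · rintro ⟨m, rfl⟩
    induction m with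
    | zero => simp
    | succ m ih =>
      rw [add_comm, zpow_add, zpow_one, Equiv.Perm.mul_apply]
      rcases ih with h | h | h <;> rw [h] <;> simp [hr]
    | pred m ih =>
      have : (r ^ (-(m : ℤ))) a = r ((r ^ (-(m : ℤ) - 1)) a) := by
        rw [← Equiv.Perm.mul_apply, ← zpow_one_add, add_sub_cancel]
      rw [this] at ih
      rcases ih with h | h | h
      · right; right
        apply r.injective
        rw [h, hr]
      · left; exact r.injective h
      · right; left; exact r.injective h
  · rintro (rfl | rfl | rfl)
    · exact SameCycle.refl _ _
    · exact ⟨1, rfl⟩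
    · exact ⟨2, rfl⟩

/-- Give weight three to a fixed point and weight one to any other point: then every cycle has total
weight three. -/
theorem three_mul_card_cycles {H : Type*} [Finite H] {r : Equiv.Perm H}
    (hr : ∀ h, r (r (r h)) = h) :
    3 * Nat.card (Quotient (SameCycle.setoid r)) =
      Nat.card H + 2 * Nat.card {h // r h = h} := by
  classical
  have := Fintype.ofFinite H
  have := Fintype.ofFinite (Quotient (SameCycle.setoid r))
  let w : H → ℕ := fun h => if r h = h then 3 else 1
  have h1 : ∀ q : Quotient (SameCycle.setoid r),
      ∑ h with Quotient.mk (SameCycle.setoid r) h = q, w h = 3 := by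
    intro q
    induction q using Quotient.inductionOn with | _ a
    have hf : (Finset.univ.filter fun h => (Quotient.mk (SameCycle.setoid r) h) =
        Quotient.mk (SameCycle.setoid r) a) = {a, r a, r (r a)} := by
      ext b
      simp only [Finset.mem_filter, Finset.mem_univ, true_and, Finset.mem_insert,
        Finset.mem_singleton]
      rw [Quotient.eq, ← sameCycle_iff_of_cube hr]
      exact sameCycle_comm
    rw [hf]
    by_cases ha : r a = a
    · simp [ha, w]
    · have h2 : r (r a) ≠ r a := fun h => ha (r.injective h)
      have h3 : r (r a) ≠ a := fun h => h2 (by rw [← h, hr, h])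
      rw [Finset.sum_insert, Finset.sum_pair h2.symm]
      · simp [w, ha, h2, hr, h3.symm]
      · simp [Ne.symm ha, h3.symm]
  have h2 := Finset.sum_fiberwise Finset.univ (Quotient.mk (SameCycle.setoid r)) w
  rw [Finset.sum_congr rfl fun q _ => h1 q] at h2
  have h3 : ∀ h, w h = 1 + 2 * (if r h = h then 1 else 0) := by
    intro h; simp only [w]; split <;> rfl
  simp_rw [h3, Finset.sum_add_distrib, ← Finset.mul_sum, Finset.sum_boole] at h2
  simp only [Finset.sum_const, Finset.card_univ, smul_eq_mul, mul_one, Nat.cast_id] at h2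
  rw [Nat.card_eq_fintype_card, Nat.card_eq_fintype_card, Nat.card_eq_fintype_card,
    Fintype.card_subtype, mul_comm, h2]

end Cycles

namespace FeynmanDiagram

variable {n : ℕ}

theorem card_halfEdge_add (F : FeynmanDiagram n) :
    Nat.card F.HalfEdge + 2 * F.numLegs = 6 * n := by
  have := three_mul_card_cycles F.rot_rot_rot
  rw [F.card_vertices] at this
  unfold numLegs IsLeg
  omega

/-! ### Existence of resolutions, and uniqueness of the functional -/

section Resolution

variable (D : FeynmanDiagram n) {l x y : D.HalfEdge}

/-- Two half-edges disappear and the number of legs rises by one, so by `card_halfEdge_add` the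
order stays `n`. The drop in half-edges is what the induction for uniqueness needs. -/
theorem exists_isResolution (hl : D.IsLeg l) (hs : ¬ D.IsLeg (D.edge l))
    (hxy : (D.rot (D.edge l) = x ∧ D.rot x = y ∧ D.rot y = D.edge l) ∨
      (D.rot (D.edge l) = y ∧ D.rot y = x ∧ D.rot x = D.edge l)) :
    ∃ D' : FeynmanDiagram n, IsResolution D D' l x y ∧
      Nat.card D'.HalfEdge < Nat.card D.HalfEdge := by
  classical
  obtain ⟨s, hse⟩ : ∃ s, s = D.edge l := ⟨_, rfl⟩
  rw [← hse] at hs hxy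
  have hcyc := hxy
  have hes : D.edge s = l := by rw [hse, D.edge_edge]
  have hxs : x ≠ s := by
    rintro rfl
    rcases hcyc with h | h
    · exact hs h.1
    · exact hs h.2.2
  have hys : y ≠ s := by
    rintro rfl
    rcases hcyc with h | h
    · exact hs h.2.2
    · exact hs h.1
  have hxy : x ≠ y := by
    rintro rfl
    rcases hcyc with h | h
    · exact hxs (D.rot.injective (h.2.1.trans h.1.symm))
    · exact hxs (h.2.1.symm.trans h.2.2)
  have hxl' : ¬ D.IsLeg x := by
    rcases hcyc with h | h
    · exact fun h' => hxy (h'.symm.trans h.2.1)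
    · exact fun h' => hxs (h'.symm.trans h.2.2)
  have hyl' : ¬ D.IsLeg y := by
    rcases hcyc with h | h
    · exact fun h' => hys (h'.symm.trans h.2.2)
    · exact fun h' => hxy (h.2.1.symm.trans h')
  have hxl : x ≠ l := fun h => hxl' (h ▸ hl)
  have hyl : y ≠ l := fun h => hyl' (h ▸ hl)
  have hsl : s ≠ l := fun h => hs (h ▸ hl)
  have hl' : D.rot l = l := hl
  have hv : ∀ h, (D.rot h = s ∨ D.rot h = x ∨ D.rot h = y) ↔ (h = s ∨ h = x ∨ h = y) := by
    intro h
    constructor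
    · rcases hcyc with ⟨h1, h2, h3⟩ | ⟨h1, h2, h3⟩
      · rintro (h' | h' | h')
        · exact Or.inr (Or.inr (D.rot.injective (h'.trans h3.symm)))
        · exact Or.inl (D.rot.injective (h'.trans h1.symm))
        · exact Or.inr (Or.inl (D.rot.injective (h'.trans h2.symm)))
      · rintro (h' | h' | h')
        · exact Or.inr (Or.inl (D.rot.injective (h'.trans h3.symm)))
        · exact Or.inr (Or.inr (D.rot.injective (h'.trans h2.symm)))
        · exact Or.inl (D.rot.injective (h'.trans h1.symm))
    · rcases hcyc with ⟨h1, h2, h3⟩ | ⟨h1, h2, h3⟩ <;> rintro (rfl | rfl | rfl) <;> tauto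
  let ρ₀ : D.HalfEdge → D.HalfEdge := fun h => if h = s ∨ h = x ∨ h = y then h else D.rot h
  have hρ₀ : Function.Injective ρ₀ := by
    intro a b hab
    simp only [ρ₀] at hab
    split_ifs at hab with h1 h2 h2
    · exact hab
    · rw [hab] at h1
      exact absurd ((hv b).1 h1) h2
    · rw [← hab] at h2
      exact absurd ((hv a).1 h2) h1
    · exact D.rot.injective hab
  let ρ : Equiv.Perm D.HalfEdge := Equiv.ofBijective ρ₀ (Finite.injective_iff_bijective.1 hρ₀)
  have hρ : ∀ h, ρ h = if h = s ∨ h = x ∨ h = y then h else D.rot h := fun _ => rfl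
  have hρl : ρ l = l := by simp [hρ, hl']
  have hρs : ρ s = s := by simp [hρ]
  -- Conjugation by the swap puts `x` in the place of `l` on the Wilson line and fixes `l`.
  -- Composing with the swap of `x` and `y` then inserts `y` directly after `x`.
  let ω₂ : Equiv.Perm D.HalfEdge :=
    Equiv.swap l x * D.wilson * (Equiv.swap l x)⁻¹
  let ω : Equiv.Perm D.HalfEdge := ω₂ * Equiv.swap x y
  have hwx : D.wilson x = x := wilson_of_not_isLeg hxl'
  have hwy : D.wilson y = y := wilson_of_not_isLeg hyl'
  have hws : D.wilson s = s := wilson_of_not_isLeg hs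
  have hω₂ : ∀ h, ω₂ h = Equiv.swap l x (D.wilson (Equiv.swap l x h)) := fun h => by
    simp [ω₂]
  have hω₂' : ∀ h, h ≠ l → h ≠ x → ω₂ h = if D.wilson h = l then x else D.wilson h := by
    intro h h1 h2
    rw [hω₂, Equiv.swap_apply_of_ne_of_ne h1 h2]
    split_ifs with h3
    · rw [h3, Equiv.swap_apply_left]
    · rw [Equiv.swap_apply_of_ne_of_ne h3]
      intro h4
      exact h2 (D.wilson.injective (h4.trans hwx.symm))
  have hω₂x : ω₂ x = if D.wilson l = l then x else D.wilson l := by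
    rw [hω₂, Equiv.swap_apply_right]
    split_ifs with h3
    · rw [h3, Equiv.swap_apply_left]
    · rw [Equiv.swap_apply_of_ne_of_ne h3]
      intro h4
      exact hxl (D.wilson.injective (hwx.trans h4.symm))
  have hω₂l : ω₂ l = l := by rw [hω₂, Equiv.swap_apply_left, hwx, Equiv.swap_apply_right]
  have hω₂y : ω₂ y = y := by rw [hω₂' y hyl hxy.symm, hwy, if_neg hyl]
  have hω₂s : ω₂ s = s := by rw [hω₂' s hsl hxs.symm, hws, if_neg hsl]
  have hω_def : ∀ h, ω h = ω₂ (Equiv.swap x y h) := fun _ => rfl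
  have hωx : ω x = y := by rw [hω_def, Equiv.swap_apply_left, hω₂y]
  have hωy : ω y = if D.wilson l = l then x else D.wilson l := by
    rw [hω_def, Equiv.swap_apply_right, hω₂x]
  have hωo : ∀ h, h ≠ x → h ≠ y → ω h = ω₂ h := fun h h1 h2 => by
    rw [hω_def, Equiv.swap_apply_of_ne_of_ne h1 h2]
  have hωl : ω l = l := by rw [hωo l hxl.symm hyl.symm, hω₂l]
  have hωs : ω s = s := by rw [hωo s hxs.symm hys.symm, hω₂s]
  have hω : ∀ h, h ≠ l → ω h = if h = x then y
      else if h = y then (if D.wilson l = l then x else D.wilson l)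
      else if D.wilson h = l then x
      else D.wilson h := by
    intro h h1
    split_ifs with h2 h3 h4 h5
    · rw [h2, hωx]
    · rw [h3, hωy, if_pos h4]
    · rw [h3, hωy, if_neg h4]
    · rw [hωo h h2 h3, hω₂' h h1 h2, if_pos h5]
    · rw [hωo h h2 h3, hω₂' h h1 h2, if_neg h5]
  have hωcyc : ∀ a, (D.rot a = a ∨ a = x ∨ a = y) → a ≠ l → ω.SameCycle x a := by
    have hstep : ∀ a, ω.SameCycle a (ω₂ a) := by
      intro a
      by_cases h1 : a = x
      · refine ⟨2, ?_⟩
        rw [h1]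
        change ω (ω x) = ω₂ x
        rw [hωx, hωy, hω₂x]
      by_cases h2 : a = y
      · rw [h2, hω₂y]
      exact ⟨1, hωo a h1 h2⟩
    intro a ha hal
    by_cases h1 : a = x
    · rw [h1]
    by_cases h2 : a = y
    · rw [h2]; exact ⟨1, hωx⟩
    have ha' : D.rot a = a := by tauto
    -- Each step of `ω₂` stays inside a cycle of `ω`, so it suffices to join `x` to `a` under the
    -- conjugate of the old Wilson line.
    refine sameCycle_map id hstep ?_
    rw [Equiv.Perm.sameCycle_conj]
    simp only [Equiv.swap_inv, Equiv.swap_apply_right, Equiv.swap_apply_of_ne_of_ne hal h1]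
    exact D.wilson_cycle l a hl ha'
  let p : D.HalfEdge → Prop := fun h => h ≠ l ∧ h ≠ s
  have hp : ∀ f : Equiv.Perm D.HalfEdge, f l = l → f s = s → ∀ h, p (f h) ↔ p h := by
    intro f h1 h2 h
    have h3 : f h = l ↔ h = l := by
      constructor
      · intro h4; exact f.injective (h4.trans h1.symm)
      · rintro rfl; exact h1
    have h4 : f h = s ↔ h = s := by
      constructor
      · intro h4; exact f.injective (h4.trans h2.symm)
      · rintro rfl; exact h2
    simp only [p, ne_eq, h3, h4]
  have hpe : ∀ h, p (D.edge h) ↔ p h := by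
    have : ∀ h, p h → p (D.edge h) := fun h hh =>
      ⟨fun h1 => hh.2 (by rw [hse, ← h1, D.edge_edge]),
        fun h1 => hh.1 (by rw [← hes, ← h1, D.edge_edge])⟩
    exact fun h => ⟨fun h1 => D.edge_edge h ▸ this _ h1, this h⟩
  let e' : Equiv.Perm {h // p h} := D.edge.subtypePerm hpe
  let ρ' : Equiv.Perm {h // p h} := ρ.subtypePerm (hp ρ hρl hρs)
  let ω' : Equiv.Perm {h // p h} := ω.subtypePerm (hp ω hωl hωs)
  have hρ3 : ∀ h, ρ' (ρ' (ρ' h)) = h := by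
    rintro ⟨h, hh⟩
    apply Subtype.ext
    change ρ (ρ (ρ h)) = h
    by_cases h1 : h = s ∨ h = x ∨ h = y
    · have : ρ h = h := by rw [hρ, if_pos h1]
      rw [this, this, this]
    · have h2 : ρ h = D.rot h := by rw [hρ, if_neg h1]
      have h3 : ρ (D.rot h) = D.rot (D.rot h) := by
        rw [hρ, if_neg (mt (hv _).1 h1)]
      have h4 : ρ (D.rot (D.rot h)) = D.rot (D.rot (D.rot h)) := by
        rw [hρ, if_neg (mt (hv _).1 (mt (hv _).1 h1))]
      rw [h2, h3, h4, D.rot_rot_rot]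
  have hρleg : ∀ h : {h // p h}, ρ' h = h ↔ (D.rot h = h ∨ (h : D.HalfEdge) = x ∨ (h : D.HalfEdge) = y) := by
    rintro ⟨h, hh⟩
    rw [Subtype.ext_iff]
    change ρ h = h ↔ (D.rot h = h ∨ h = x ∨ h = y)
    rw [hρ]
    split_ifs with h1
    · rcases h1 with rfl | h1
      · exact absurd rfl hh.2
      · simp [h1]
    · tauto
  have hcard : Nat.card {h // p h} + 2 = Nat.card D.HalfEdge := by
    have h1 : ({l, s} : Finset D.HalfEdge).card = 2 := Finset.card_pair hsl.symm
    have h2 := Finset.card_compl_add_card ({l, s} : Finset D.HalfEdge)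
    rw [h1] at h2
    rw [Nat.card_eq_fintype_card (α := D.HalfEdge), ← h2, Nat.card_eq_fintype_card,
      Fintype.card_subtype]
    congr 2
    ext h
    simp [p]
  have hcardleg : Nat.card {h // ρ' h = h} = D.numLegs + 1 := by
    have h1 : Nat.card {h // ρ' h = h} =
        (insert x (insert y ((Finset.univ.filter fun h => D.rot h = h).erase l))).card := by
      rw [Nat.card_eq_fintype_card, Fintype.card_subtype,
        ← Finset.card_map (Function.Embedding.subtype p)]
      congr 1
      ext h
      simp only [Finset.mem_map, Finset.mem_filter, Finset.mem_univ, true_and, hρleg,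
        Function.Embedding.subtype_apply, Finset.mem_insert, Finset.mem_erase]
      constructor
      · rintro ⟨a, ha, rfl⟩
        have := a.2.1
        tauto
      · intro hh
        refine ⟨⟨h, ?_, ?_⟩, ?_, rfl⟩
        · rcases hh with rfl | rfl | hh
          exacts [hxl, hyl, hh.1]
        · rcases hh with rfl | rfl | hh
          · exact hxs
          · exact hys
          · rintro rfl
            exact hs hh.2
        · tauto
    have h2 : (Finset.univ.filter fun h => D.rot h = h).card = D.numLegs := by
      rw [numLegs, Nat.card_eq_fintype_card, Fintype.card_subtype]
      rfl
    have h3 : 0 < (Finset.univ.filter fun h => D.rot h = h).card :=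
      Finset.card_pos.2 ⟨l, by simp [hl']⟩
    rw [h1, Finset.card_insert_of_notMem, Finset.card_insert_of_notMem, Finset.card_erase_of_mem]
    · omega
    · simp [hl']
    · simp only [Finset.mem_erase, Finset.mem_filter, Finset.mem_univ, true_and, not_and]
      exact fun _ => hyl'
    · simp only [Finset.mem_insert, Finset.mem_erase, Finset.mem_filter, Finset.mem_univ,
        true_and, not_or, not_and]
      exact ⟨hxy, fun _ => hxl'⟩
  have hcv : Nat.card (Quotient (Equiv.Perm.SameCycle.setoid ρ')) = 2 * n := by
    have h1 := three_mul_card_cycles hρ3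
    have h2 := D.card_halfEdge_add
    omega
  have hfin : Finite {h // p h} := inferInstance
  have hwl : ∀ h, ρ' h ≠ h → ω' h = h := by
    intro h hh
    rw [Ne, hρleg] at hh
    push Not at hh
    apply Subtype.ext
    change ω h = h
    have h1 : D.wilson h = h := D.wilson_of_not_leg _ hh.1
    rw [hωo h hh.2.1 hh.2.2, hω₂' h h.2.1 hh.2.1, h1, if_neg h.2.1]
  have hwc : ∀ h h', ρ' h = h → ρ' h' = h' → ω'.SameCycle h h' := by
    intro h h' h1 h2
    rw [Equiv.Perm.sameCycle_subtypePerm]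
    exact (hωcyc h ((hρleg h).1 h1) h.2.1).symm.trans (hωcyc h' ((hρleg h').1 h2) h'.2.1)
  -- Follow the old path to a leg. It can reach the deleted part only from `x` or `y`, and these are
  -- now legs themselves, so it is cut there.
  have hexl : ∀ h, ∃ m, ρ' m = m ∧ Relation.ReflTransGen (fun a b => b = e' a ∨ b = ρ' a) h m := by
    rintro ⟨h, hh⟩
    obtain ⟨m, hm, hpath⟩ := D.exists_leg h
    induction hpath using Relation.ReflTransGen.head_induction_on with
    | refl => exact ⟨⟨m, hh⟩, (hρleg _).2 (Or.inl hm), .refl⟩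
    | @head a c h1 _ ih =>
      by_cases hxy' : a = x ∨ a = y
      · exact ⟨⟨a, hh⟩, (hρleg _).2 (Or.inr hxy'), .refl⟩
      have ha : ¬ (a = s ∨ a = x ∨ a = y) := fun h => h.elim hh.2 hxy'
      have hc : p c := by
        rcases h1 with rfl | rfl
        · exact (hpe _).2 hh
        · exact ⟨fun h => hh.1 (D.rot.injective (h.trans hl'.symm)),
            fun h => ha ((hv _).1 (Or.inl h))⟩
      obtain ⟨m', hm', hpath'⟩ := ih hc
      refine ⟨m', hm', .head ?_ hpath'⟩
      rcases h1 with rfl | rfl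
      · left; rfl
      · right
        apply Subtype.ext
        change D.rot a = ρ a
        rw [hρ, if_neg ha]
  have hrange : Set.range (Subtype.val : {h // p h} → D.HalfEdge) = {l, D.edge l}ᶜ := by
    rw [← hse]
    ext h
    constructor
    · rintro ⟨a, rfl⟩
      simp [a.2.1, a.2.2]
    · intro hh
      exact ⟨⟨h, by simpa [p] using hh⟩, rfl⟩
  refine ⟨{
    HalfEdge := {h // p h}
    finite := hfin
    edge := e'
    edge_edge := fun h => Subtype.ext (D.edge_edge h)
    edge_ne := fun h h1 => D.edge_ne h (Subtype.ext_iff.1 h1)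
    rot := ρ'
    rot_rot_rot := hρ3
    card_vertices := hcv
    wilson := ω'
    wilson_of_not_leg := hwl
    wilson_cycle := hwc
    exists_leg := hexl }, ⟨Subtype.val, Subtype.val_injective, ?_, fun _ => rfl, fun h => ?_,
      fun h => ?_⟩, ?_⟩
  · exact hrange
  · change ρ h = _
    rw [hρ]
    exact if_congr ⟨fun h1 => h1.resolve_left h.2.2, Or.inr⟩ rfl rfl
  · exact hω h h.2.1
  · change Nat.card {h // p h} < _
    omega

end Resolution

/-- On a path from a trivalent vertex to a leg, the first arrival at a leg must be along an edge,
since `rot` preserves being a leg. -/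
theorem exists_leg_edge_not_isLeg {F : FeynmanDiagram n} (hF : ¬ F.IsChordDiagram) :
    ∃ l, F.IsLeg l ∧ ¬ F.IsLeg (F.edge l) := by
  obtain ⟨h, hh⟩ := not_forall.1 hF
  obtain ⟨m, hm, hp⟩ := F.exists_leg h
  have hm : F.IsLeg m := hm
  induction hp using Relation.ReflTransGen.head_induction_on with
  | refl => exact absurd hm hh
  | @head a c h1 _ ih =>
    by_cases hc : F.IsLeg c
    · rcases h1 with rfl | rfl
      · exact ⟨_, hc, by rwa [F.edge_edge]⟩
      · exact absurd (IsLeg.rot_iff.1 hc) hh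
    · exact ih hc

theorem exists_isSTU {F : FeynmanDiagram n} (hF : ¬ F.IsChordDiagram) :
    ∃ DP DX, IsSTU F DP DX ∧ Nat.card DP.HalfEdge < Nat.card F.HalfEdge ∧
      Nat.card DX.HalfEdge < Nat.card F.HalfEdge := by
  obtain ⟨l, hl, hs⟩ := exists_leg_edge_not_isLeg hF
  obtain ⟨DP, hP, hP'⟩ := F.exists_isResolution (x := F.rot (F.rot (F.edge l)))
    (y := F.rot (F.edge l)) hl hs (Or.inr ⟨rfl, rfl, F.rot_rot_rot _⟩)
  obtain ⟨DX, hX, hX'⟩ := F.exists_isResolution (x := F.rot (F.edge l))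
    (y := F.rot (F.rot (F.edge l))) hl hs (Or.inl ⟨rfl, rfl, F.rot_rot_rot _⟩)
  exact ⟨DP, DX, ⟨l, hl, hs, hP, hX⟩, hP', hX'⟩

end FeynmanDiagram

section Functional

variable {k : Type*} [Field k] {n : ℕ}

theorem cls_of_isSTU {DY DP DX : FeynmanDiagram n} (h : FeynmanDiagram.IsSTU DY DP DX) :
    cls k DY = cls k DP - cls k DX := by
  rw [← sub_eq_zero, sub_sub_eq_add_sub, cls, cls, cls, ← map_add, ← map_sub,
    Submodule.mkQ_apply, Submodule.Quotient.mk_eq_zero]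
  refine Submodule.subset_span (Or.inr ⟨DY, DP, DX, h, ?_⟩)
  abel

/-- Chord diagrams span: strong induction on the number of half-edges, resolving one vertex at a
time. -/
theorem IsAlexanderConway.unique {C C' : DiagramSpace k n →ₗ[k] k} (hC : IsAlexanderConway C)
    (hC' : IsAlexanderConway C') : C = C' := by
  have key : ∀ (m : ℕ) (F : FeynmanDiagram n), Nat.card F.HalfEdge = m →
      C (cls k F) = C' (cls k F) := by
    intro m
    induction m using Nat.strong_induction_on with | _ m ih
    intro F hF
    by_cases h : F.IsChordDiagram
    · rw [hC F h, hC' F h]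
    · obtain ⟨DP, DX, hSTU, hP, hX⟩ := FeynmanDiagram.exists_isSTU h
      rw [cls_of_isSTU hSTU, map_sub, map_sub, ih _ (hF ▸ hP) DP rfl, ih _ (hF ▸ hX) DX rfl]
  apply Submodule.linearMap_qext
  apply Finsupp.lhom_ext'
  intro F
  ext
  exact key _ F rfl

end Functional

/-! ### Transitivity of a permutation as a determinant -/

section Determinant

variable {H : Type*} [Fintype H] [DecidableEq H]

theorem det_eq_zero_of_add_eq_zero {N : H → H → ℤ} {a b : H} (hab : a ≠ b)
    (h : ∀ x, N x a + N x b = 0) : Matrix.detRowAlternating N = 0 := by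
  change Matrix.det (Matrix.of N) = 0
  refine Matrix.exists_mulVec_eq_zero_iff.1 ⟨Pi.single a 1 + Pi.single b 1, ?_, ?_⟩
  · intro h0
    have := congr_fun h0 a
    simp [hab] at this
  · rw [Matrix.mulVec_add]
    ext x
    simpa using h x

theorem det_eq_zero_of_eq_sub {N : H → H → ℤ} {i j l : H} (hij : i ≠ j) (hil : i ≠ l)
    (h : N i = N j - N l) : Matrix.detRowAlternating N = 0 := by
  have h1 : N = Function.update N i (N j - N l) := by rw [← h, Function.update_eq_self]
  rw [h1, AlternatingMap.map_update_sub, AlternatingMap.map_update_self _ _ hij,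
    AlternatingMap.map_update_self _ _ hil, sub_zero]

/-- The rows of `1 - P`, where `P` is the permutation matrix, with the row `x₀` replaced by a
basis vector. -/
def cycleRows (π : Equiv.Perm H) (x₀ x : H) : H → ℤ :=
  if x = x₀ then Pi.single x₀ 1 else Pi.single x 1 - Pi.single (π x) 1

/-- The indicator function of the complement of the cycle of `x₀` is a nonzero kernel vector: it is
constant on cycles and vanishes at `x₀`. -/
theorem det_cycleRows_of_not_isTransitive {π : Equiv.Perm H} (hπ : ¬ IsTransitive π) (x₀ : H) :
    Matrix.detRowAlternating (cycleRows π x₀) = 0 := by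
  classical
  obtain ⟨y, hy⟩ : ∃ y, ¬ π.SameCycle x₀ y := by
    by_contra! h
    exact hπ fun a b => (h a).symm.trans (h b)
  change Matrix.det (Matrix.of (cycleRows π x₀)) = 0
  have hx₀ : π.SameCycle x₀ x₀ := Equiv.Perm.SameCycle.refl _ _
  refine Matrix.exists_mulVec_eq_zero_iff.1 ⟨fun x => if π.SameCycle x₀ x then 0 else 1, ?_, ?_⟩
  · intro h0
    have := congr_fun h0 y
    simp [hy] at this
  · ext x
    change cycleRows π x₀ x ⬝ᵥ _ = 0
    rw [cycleRows]
    split_ifs with hx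
    · simp [single_dotProduct, hx₀]
    · rw [sub_dotProduct, single_dotProduct, single_dotProduct]
      simp

/-- Order the points by the number of steps to `x₀`. Every row other than that of `x₀` involves its
own point and a strictly earlier one, so the matrix is triangular with unit diagonal. -/
theorem det_cycleRows_of_isTransitive {π : Equiv.Perm H} (hπ : IsTransitive π) (x₀ : H) :
    Matrix.detRowAlternating (cycleRows π x₀) = 1 := by
  classical
  have hex : ∀ x, ∃ m : ℕ, (π ^ m) x = x₀ := fun x => by
    obtain ⟨m, _, hm⟩ := (hπ x x₀).exists_pow_eq'
    exact ⟨m, hm⟩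
  let d : H → ℕ := fun x => Nat.find (hex x)
  have hd : ∀ x, (π ^ d x) x = x₀ := fun x => Nat.find_spec (hex x)
  have hinj : Function.Injective d := fun a b hab => by
    have h1 := hd a
    rw [hab, ← hd b] at h1
    exact (π ^ d b).injective h1
  have hlt : ∀ x, x ≠ x₀ → d (π x) < d x := fun x hx => by
    have h0 : d x ≠ 0 := fun h => hx (by simpa [h] using hd x)
    obtain ⟨m, hm⟩ := Nat.exists_eq_succ_of_ne_zero h0
    have h1 : (π ^ m) (π x) = x₀ := by
      rw [← Equiv.Perm.mul_apply, ← pow_succ, ← Nat.succ_eq_add_one, ← hm, hd]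
    have := Nat.find_min' (hex (π x)) h1
    change d (π x) ≤ m at this
    omega
  let _ : LinearOrder H := LinearOrder.lift' d hinj
  have hle : ∀ a b : H, a < b ↔ d a < d b := fun a b => Iff.rfl
  change Matrix.det (Matrix.of (cycleRows π x₀)) = 1
  have ht : (Matrix.of (cycleRows π x₀)).BlockTriangular OrderDual.toDual := by
    intro x y hxy
    have hxy : x < y := hxy
    rw [hle] at hxy
    simp only [Matrix.of_apply, cycleRows]
    split_ifs with hx
    · subst hx
      exact Pi.single_eq_of_ne (by rintro rfl; exact lt_irrefl _ hxy) _
    · have := hlt x hx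
      rw [Pi.sub_apply, Pi.single_eq_of_ne (by rintro rfl; exact lt_irrefl _ hxy),
        Pi.single_eq_of_ne (by rintro rfl; omega), sub_zero]
  have := Matrix.det_of_isLowerTriangular (Matrix.of (cycleRows π x₀)) ht
  convert this using 1
  symm
  apply Finset.prod_eq_one
  intro x _
  simp only [Matrix.of_apply, cycleRows]
  split_ifs with hx
  · simp [hx]
  · have := hlt x hx
    rw [Pi.sub_apply, Pi.single_eq_same, Pi.single_eq_of_ne, sub_zero]
    intro h
    rw [← h] at this
    exact lt_irrefl _ this

end Determinant

/-! ### Multilinear algebra of the three rows at a vertex -/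

section Trilinear

/-- The vectors are the basis vectors of the half-edges at a vertex and, primed, of their partners;
the left side compares the two cyclic orderings. The terms with three primes cancel, as do those
with none. Each remaining term contains a pair such as `S, S'` and can be collected into a
difference `S' - S`, `B' - B` or `C' - C`. -/
theorem trilinear_vertex {V : Type*} [AddCommGroup V] (T : V → V → V → ℤ)
    (h1 : ∀ a b v w, T (a - b) v w = T a v w - T b v w)
    (h2 : ∀ a b u w, T u (a - b) w = T u a w - T u b w)
    (h3 : ∀ a b u v, T u v (a - b) = T u v a - T u v b)
    (h12 : ∀ a b c, T b a c = -T a b c) (h23 : ∀ a b c, T a c b = -T a b c)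
    (S B C S' B' C' : V) :
    T (S' - B) (B' - C) (C' - S) - T (S' - C) (B' - S) (C' - B) =
      (T (S' - S) B' B + T (S' - S) C' C) + (T C (B' - B) C' + T S (B' - B) S') +
        (T S' S (C' - C) + T B' B (C' - C)) := by
  have p1 : ∀ x y z, T y z x = T x y z := fun x y z => by rw [h23, h12, neg_neg]
  have p2 : ∀ x y z, T z x y = T x y z := fun x y z => by rw [h12, h23, neg_neg]
  have p3 : ∀ x y z, T z y x = -T x y z := fun x y z => by rw [h12, p1]
  simp only [h1, h2, h3]
  have key : ∀ x y z, T y x z = -T x y z ∧ T x z y = -T x y z ∧ T y z x = T x y z ∧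
      T z x y = T x y z ∧ T z y x = -T x y z := fun x y z =>
    ⟨h12 _ _ _, h23 _ _ _, p1 _ _ _, p2 _ _ _, p3 _ _ _⟩
  have k1 := key S S' B
  have k2 := key S S' B'
  have k3 := key S S' C
  have k4 := key S S' C'
  have k5 := key B B' S
  have k6 := key B B' S'
  have k7 := key B B' C
  have k8 := key B B' C'
  have k9 := key C C' S
  have k10 := key C C' S'
  have k11 := key C C' B
  have k12 := key C C' B'
  have k13 := key S B C
  omega

end Trilinear

section Update

variable {H : Type*} [DecidableEq H]

/-- Replace the rows `i`, `j`, `l`. -/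
def replaceRows (N : H → H → ℤ) (i j l : H) (u v w : H → ℤ) : H → H → ℤ :=
  Function.update (Function.update (Function.update N i u) j v) l w

variable {N : H → H → ℤ} {i j l : H} {u v w : H → ℤ}

theorem replaceRows_of_ne {x : H} (hi : x ≠ i) (hj : x ≠ j) (hl : x ≠ l) :
    replaceRows N i j l u v w x = N x := by
  simp [replaceRows, hi, hj, hl]

theorem replaceRows_left (hij : i ≠ j) (hil : i ≠ l) : replaceRows N i j l u v w i = u := by
  simp [replaceRows, hij, hil]

theorem replaceRows_middle (hjl : j ≠ l) : replaceRows N i j l u v w j = v := by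
  simp [replaceRows, hjl]

theorem replaceRows_right : replaceRows N i j l u v w l = w := by
  simp [replaceRows]

theorem eq_replaceRows {M : H → H → ℤ} (hij : i ≠ j) (hil : i ≠ l) (hjl : j ≠ l)
    (h : ∀ x, x ≠ i → x ≠ j → x ≠ l → M x = N x) (hi : M i = u) (hj : M j = v) (hl : M l = w) :
    M = replaceRows N i j l u v w := by
  funext x
  by_cases h1 : x = i
  · rw [h1, replaceRows_left hij hil, hi]
  by_cases h2 : x = j
  · rw [h2, replaceRows_middle hjl, hj]
  by_cases h3 : x = l
  · rw [h3, replaceRows_right, hl]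
  rw [replaceRows_of_ne h1 h2 h3, h x h1 h2 h3]

theorem replaceRows_rotate (hij : i ≠ j) (hil : i ≠ l) (hjl : j ≠ l) :
    replaceRows N j l i u v w = replaceRows N i j l w u v :=
  eq_replaceRows hij hil hjl (fun _ h1 h2 h3 => replaceRows_of_ne h2 h3 h1)
    replaceRows_right (replaceRows_left hjl hij.symm) (replaceRows_middle hil.symm)

theorem det_replaceRows_vertex [Fintype H] (hij : i ≠ j) (hil : i ≠ l) (hjl : j ≠ l)
    (S B C S' B' C' : H → ℤ) :
    Matrix.detRowAlternating (replaceRows N i j l (S' - B) (B' - C) (C' - S)) -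
        Matrix.detRowAlternating (replaceRows N i j l (S' - C) (B' - S) (C' - B)) =
      (Matrix.detRowAlternating (replaceRows N i j l (S' - S) B' B) +
          Matrix.detRowAlternating (replaceRows N i j l (S' - S) C' C)) +
        (Matrix.detRowAlternating (replaceRows N j l i (B' - B) C' C) +
          Matrix.detRowAlternating (replaceRows N j l i (B' - B) S' S)) +
        (Matrix.detRowAlternating (replaceRows N l i j (C' - C) S' S) +
          Matrix.detRowAlternating (replaceRows N l i j (C' - C) B' B)) := by
  have hr1 : ∀ u v w, replaceRows N j l i u v w = replaceRows N i j l w u v := fun u v w =>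
    replaceRows_rotate hij hil hjl
  have hr2 : ∀ u v w, replaceRows N l i j u v w = replaceRows N i j l v w u := fun u v w => by
    rw [replaceRows_rotate hjl hij.symm hil.symm, hr1]
  simp only [hr1, hr2]
  have e1 : ∀ u v w, replaceRows N i j l u v w =
      Function.update (Function.update (Function.update N j v) l w) i u := fun u v w => by
    rw [← replaceRows_rotate hij hil hjl]; rfl
  have e2 : ∀ u v w, replaceRows N i j l u v w =
      Function.update (Function.update (Function.update N l w) i u) j v := fun u v w => by
    rw [← hr2]; rfl
  refine trilinear_vertex
    (fun u v w => Matrix.detRowAlternating (replaceRows N i j l u v w)) ?_ ?_ ?_ ?_ ?_ S B C S' B' C'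
  · intro a b v w
    simp only [e1, AlternatingMap.map_update_sub]
  · intro a b v w
    simp only [e2, AlternatingMap.map_update_sub]
  · intro a b v w
    simp only [replaceRows, AlternatingMap.map_update_sub]
  · intro a b c
    rw [← AlternatingMap.map_swap _ _ hij]
    congr 1
    symm
    refine eq_replaceRows hij hil hjl (fun x h1 h2 h3 => ?_) ?_ ?_ ?_
    · simp [Equiv.swap_apply_of_ne_of_ne h1 h2, replaceRows_of_ne h1 h2 h3]
    · simp [replaceRows_middle hjl]
    · simp [replaceRows_left hij hil]
    · simp [Equiv.swap_apply_of_ne_of_ne hil.symm hjl.symm, replaceRows_right]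
  · intro a b c
    rw [← AlternatingMap.map_swap _ _ hjl]
    congr 1
    symm
    refine eq_replaceRows hij hil hjl (fun x h1 h2 h3 => ?_) ?_ ?_ ?_
    · simp [Equiv.swap_apply_of_ne_of_ne h2 h3, replaceRows_of_ne h1 h2 h3]
    · simp [Equiv.swap_apply_of_ne_of_ne hij hil, replaceRows_left hij hil]
    · simp [replaceRows_right]
    · simp [replaceRows_middle hjl]

end Update

/-! ### Reversing the ordering at one vertex -/

namespace FeynmanDiagram

variable {n : ℕ} {F : FeynmanDiagram n}

theorem not_isLeg_rot {s : F.HalfEdge} (hs : ¬ F.IsLeg s) : ¬ F.IsLeg (F.rot s) :=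
  mt IsLeg.rot_iff.1 hs

theorem rot_ne {s : F.HalfEdge} (hs : ¬ F.IsLeg s) : F.rot s ≠ s := hs

theorem rot_rot_ne {s : F.HalfEdge} (hs : ¬ F.IsLeg s) : F.rot (F.rot s) ≠ s := fun h =>
  hs (by have := F.rot_rot_rot s; rwa [h] at this)

/-- The half-edges at the vertex of `s`. -/
def AtVertex (s h : F.HalfEdge) : Prop := h = s ∨ h = F.rot s ∨ h = F.rot (F.rot s)

theorem atVertex_self (s : F.HalfEdge) : AtVertex s s := Or.inl rfl

theorem atVertex_rot_iff {s h : F.HalfEdge} : AtVertex s (F.rot h) ↔ AtVertex s h := by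
  unfold AtVertex
  rw [EmbeddingLike.apply_eq_iff_eq, EmbeddingLike.apply_eq_iff_eq]
  have : F.rot h = s ↔ h = F.rot (F.rot s) := by
    rw [← rot_symm, Equiv.eq_symm_apply]
  rw [this]
  tauto

theorem AtVertex.isLeg_iff {s h : F.HalfEdge} (hh : AtVertex s h) : F.IsLeg h ↔ F.IsLeg s := by
  rcases hh with rfl | rfl | rfl
  · rfl
  · exact IsLeg.rot_iff
  · rw [IsLeg.rot_iff, IsLeg.rot_iff]

theorem AtVertex.symm {s h : F.HalfEdge} (hh : AtVertex s h) : AtVertex h s := by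
  rcases hh with rfl | rfl | rfl
  · exact Or.inl rfl
  · exact Or.inr (Or.inr (F.rot_rot_rot _).symm)
  · exact Or.inr (Or.inl (F.rot_rot_rot _).symm)

namespace State

open Classical in
/-- Reverse the cyclic ordering at the vertex of `s`. -/
noncomputable def toggle {s : F.HalfEdge} (hs : ¬ F.IsLeg s) (ε : F.State) : F.State where
  val h := if AtVertex s h then !ε.val h else ε.val h
  val_rot h := by rw [ε.val_rot]; exact if_congr atVertex_rot_iff rfl rfl
  val_of_isLeg h hh := by
    rw [if_neg, ε.val_of_isLeg h hh]
    exact fun h' => hs (h'.isLeg_iff.1 hh)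

variable {s : F.HalfEdge} (hs : ¬ F.IsLeg s) (ε : F.State)

theorem toggle_val_of_atVertex {h : F.HalfEdge} (hh : AtVertex s h) :
    (ε.toggle hs).val h = !ε.val h := if_pos hh

theorem toggle_val_of_not_atVertex {h : F.HalfEdge} (hh : ¬ AtVertex s h) :
    (ε.toggle hs).val h = ε.val h := if_neg hh

theorem toggle_toggle : (ε.toggle hs).toggle hs = ε := by
  refine State.ext fun h => ?_
  by_cases hh : AtVertex s h
  · rw [toggle_val_of_atVertex hs _ hh, toggle_val_of_atVertex hs _ hh, Bool.not_not]
  · rw [toggle_val_of_not_atVertex hs _ hh, toggle_val_of_not_atVertex hs _ hh]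

/-- The sign is a product over half-edges, and exactly three distinct ones are flipped. -/
theorem sign_toggle : (ε.toggle hs).sign = -ε.sign := by
  classical
  have h1 : ∀ h, (if (ε.toggle hs).val h then (-1 : ℤ) else 1) =
      (if ε.val h then -1 else 1) *
        ((if h = s then -1 else 1) * (if h = F.rot s then -1 else 1) *
          (if h = F.rot (F.rot s) then -1 else 1)) := by
    intro h
    have d1 := rot_ne hs
    have d2 := rot_rot_ne hs
    have d3 : F.rot (F.rot s) ≠ F.rot s := fun h => d1 (F.rot.injective h)
    by_cases hh : AtVertex s h
    · rw [toggle_val_of_atVertex hs _ hh]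
      rcases hh with rfl | rfl | rfl
      · cases ε.val h <;> simp [d1.symm, d2.symm]
      · cases ε.val (F.rot s) <;> simp [d1, d3.symm]
      · cases ε.val (F.rot (F.rot s)) <;> simp [d2, d3]
    · rw [toggle_val_of_not_atVertex hs _ hh]
      unfold AtVertex at hh
      push Not at hh
      simp [hh.1, hh.2.1, hh.2.2]
  rw [sign, Finset.prod_congr rfl fun h _ => h1 h]
  simp_rw [Finset.prod_mul_distrib, Finset.prod_ite_eq' Finset.univ]
  simp [sign]

/-- Reversal is an involution on states. The sum is an integer, so the factor two can later be
cancelled before passing to the field, whatever its characteristic. -/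
theorem two_mul_sum (g : F.State → ℤ) :
    2 * ∑ ε, g ε = ∑ ε, (g ε + g (toggle hs ε)) := by
  rw [Finset.sum_add_distrib, two_mul]
  congr 1
  exact (Equiv.sum_comp ⟨toggle hs, toggle hs, toggle_toggle hs, toggle_toggle hs⟩ g).symm

theorem facePerm_toggle {x : F.HalfEdge} (hx : ¬ AtVertex s (F.edge x)) :
    (ε.toggle hs).facePerm x = ε.facePerm x := by
  rw [facePerm_apply, facePerm_apply, vertexPerm_apply, vertexPerm_apply,
    toggle_val_of_not_atVertex hs _ hx]

theorem single_eq_det [DecidableEq F.HalfEdge] (x₀ : F.HalfEdge) :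
    ε.single = Matrix.detRowAlternating (cycleRows ε.facePerm x₀) := by
  unfold single
  split_ifs with h
  · exact (det_cycleRows_of_isTransitive h x₀).symm
  · exact (det_cycleRows_of_not_isTransitive h x₀).symm

end State

/-- Replace the rows of the three edges at the vertex of `s`. -/
def replaceVertex [DecidableEq F.HalfEdge] (N : F.HalfEdge → F.HalfEdge → ℤ) (s : F.HalfEdge)
    (u v w : F.HalfEdge → ℤ) : F.HalfEdge → F.HalfEdge → ℤ :=
  replaceRows N (F.edge s) (F.edge (F.rot s)) (F.edge (F.rot (F.rot s))) u v w

/-- The row of an edge. -/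
def edgeRow [DecidableEq F.HalfEdge] (s : F.HalfEdge) : F.HalfEdge → ℤ :=
  Pi.single (F.edge s) 1 - Pi.single s 1

/-- The terms of the difference of the two states at the vertex of `s` in which the row of `s` is
the edge row. -/
noncomputable def vertexDet [DecidableEq F.HalfEdge] (N : F.HalfEdge → F.HalfEdge → ℤ)
    (s : F.HalfEdge) : ℤ :=
  Matrix.detRowAlternating (replaceVertex N s (edgeRow s)
      (Pi.single (F.edge (F.rot s)) 1) (Pi.single (F.rot s) 1)) +
    Matrix.detRowAlternating (replaceVertex N s (edgeRow s)
      (Pi.single (F.edge (F.rot (F.rot s))) 1) (Pi.single (F.rot (F.rot s)) 1))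

theorem edge_injective_ne {a b : F.HalfEdge} (h : a ≠ b) : F.edge a ≠ F.edge b :=
  fun h' => h (F.edge.injective h')

section

variable [DecidableEq F.HalfEdge] {s : F.HalfEdge}

/-- `M` and `M'` are the matrices for the two orderings at the vertex. The common matrix `N` is kept
arbitrary so that the formula can be used again after rows at a neighbouring vertex have been
replaced. -/
theorem det_vertex_sub (hs : ¬ F.IsLeg s) {M M' N : F.HalfEdge → F.HalfEdge → ℤ}
    (hM : ∀ x, ¬ AtVertex s (F.edge x) → M x = N x)
    (hM' : ∀ x, ¬ AtVertex s (F.edge x) → M' x = N x)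
    (hMs : ∀ h, AtVertex s h → M (F.edge h) = Pi.single (F.edge h) 1 - Pi.single (F.rot h) 1)
    (hMs' : ∀ h, AtVertex s h →
      M' (F.edge h) = Pi.single (F.edge h) 1 - Pi.single (F.rot (F.rot h)) 1) :
    Matrix.detRowAlternating M - Matrix.detRowAlternating M' =
      vertexDet N s + vertexDet N (F.rot s) + vertexDet N (F.rot (F.rot s)) := by
  have d1 := edge_injective_ne (rot_ne hs).symm
  have d2 := edge_injective_ne (rot_rot_ne hs).symm
  have d3 := edge_injective_ne (rot_ne (not_isLeg_rot hs)).symm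
  have a1 : AtVertex s s := Or.inl rfl
  have a2 : AtVertex s (F.rot s) := Or.inr (Or.inl rfl)
  have a3 : AtVertex s (F.rot (F.rot s)) := Or.inr (Or.inr rfl)
  have hn : ∀ x, x ≠ F.edge s → x ≠ F.edge (F.rot s) → x ≠ F.edge (F.rot (F.rot s)) →
      ¬ AtVertex s (F.edge x) := by
    rintro x h1 h2 h3 (h | h | h)
    · exact h1 (by rw [← h, F.edge_edge])
    · exact h2 (by rw [← h, F.edge_edge])
    · exact h3 (by rw [← h, F.edge_edge])
  have e1 := eq_replaceRows d1 d2 d3 (fun x h1 h2 h3 => hM x (hn x h1 h2 h3)) (hMs _ a1)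
    (hMs _ a2) (hMs _ a3)
  have e2 := eq_replaceRows d1 d2 d3 (fun x h1 h2 h3 => hM' x (hn x h1 h2 h3)) (hMs' _ a1)
    (hMs' _ a2) (hMs' _ a3)
  rw [F.rot_rot_rot] at e1
  simp only [F.rot_rot_rot] at e2
  rw [e1, e2, det_replaceRows_vertex d1 d2 d3]
  simp only [vertexDet, replaceVertex, edgeRow, F.rot_rot_rot]

end

end FeynmanDiagram

/-! ### Vanishing at a trivalent vertex without neighbouring legs -/

namespace FeynmanDiagram

variable {n : ℕ} {F : FeynmanDiagram n}

theorem atVertex_rot_left {s h : F.HalfEdge} : AtVertex (F.rot s) h ↔ AtVertex s h := by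
  unfold AtVertex
  rw [F.rot_rot_rot]
  tauto

theorem AtVertex.trans {a b c : F.HalfEdge} (h1 : AtVertex a b) (h2 : AtVertex b c) :
    AtVertex a c := by
  rcases h1 with rfl | rfl | rfl
  · exact h2
  · exact atVertex_rot_left.1 h2
  · exact atVertex_rot_left.1 (atVertex_rot_left.1 h2)

theorem State.val_eq_of_atVertex (ε : F.State) {a b : F.HalfEdge} (h : AtVertex a b) :
    ε.val b = ε.val a := by
  rcases h with rfl | rfl | rfl
  · rfl
  · rw [ε.rot_apply]
  · rw [ε.rot_apply, ε.rot_apply]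

/-- The Wilson line moves only legs, so a curve enters a trivalent half-edge from an edge ending at
the same vertex. This controls which rows meet the column of `a`. -/
theorem facePerm_eq_of_not_isLeg {ε : F.State} {x a : F.HalfEdge} (ha : ¬ F.IsLeg a)
    (h : ε.facePerm x = a) : AtVertex a (F.edge x) := by
  rw [State.facePerm_apply] at h
  have h1 : ¬ F.IsLeg (ε.vertexPerm (F.edge x)) := by
    rw [← isLeg_wilson_iff, h]; exact ha
  rw [wilson_of_not_isLeg h1, State.vertexPerm_apply] at h
  refine AtVertex.symm ?_
  rw [← h]
  split
  · exact Or.inr (Or.inl rfl)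
  · rw [rot_symm]; exact Or.inr (Or.inr rfl)

section

variable [DecidableEq F.HalfEdge] {s : F.HalfEdge}

theorem det_replaceVertex_eq_zero {N : F.HalfEdge → F.HalfEdge → ℤ} (hs : ¬ F.IsLeg s)
    {a b : F.HalfEdge} (hab : a ≠ b) (hN : ∀ x, ¬ AtVertex s (F.edge x) → N x a + N x b = 0)
    {u v w : F.HalfEdge → ℤ} (hu : u a + u b = 0) (hv : v a + v b = 0) (hw : w a + w b = 0) :
    Matrix.detRowAlternating (replaceVertex N s u v w) = 0 := by
  have d1 := edge_injective_ne (rot_ne hs).symm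
  have d2 := edge_injective_ne (rot_rot_ne hs).symm
  have d3 := edge_injective_ne (rot_ne (not_isLeg_rot hs)).symm
  refine det_eq_zero_of_add_eq_zero hab fun x => ?_
  by_cases h1 : x = F.edge s
  · rw [h1, replaceVertex, replaceRows_left d1 d2, hu]
  by_cases h2 : x = F.edge (F.rot s)
  · rw [h2, replaceVertex, replaceRows_middle d3, hv]
  by_cases h3 : x = F.edge (F.rot (F.rot s))
  · rw [h3, replaceVertex, replaceRows_right, hw]
  rw [replaceVertex, replaceRows_of_ne h1 h2 h3]
  apply hN
  rintro (h | h | h)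
  · exact h1 (by rw [← h, F.edge_edge])
  · exact h2 (by rw [← h, F.edge_edge])
  · exact h3 (by rw [← h, F.edge_edge])

/-- All six determinants vanish. In four of them the columns of `t` and `edge t` are opposite. In
the other two, basis vectors of `t` and `edge t` both appear as rows, and their difference is the
row `N t`. -/
theorem vertexDet_sum_eq_zero {t : F.HalfEdge} (ht : ¬ F.IsLeg t)
    (hst : ¬ AtVertex t (F.edge t)) {N : F.HalfEdge → F.HalfEdge → ℤ}
    (hN : ∀ x, ¬ AtVertex t (F.edge x) → N x (F.edge t) + N x t = 0)
    (hNt : N t = Pi.single t 1 - Pi.single (F.edge t) 1) :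
    vertexDet N t + vertexDet N (F.rot t) + vertexDet N (F.rot (F.rot t)) = 0 := by
  have hb := rot_ne ht
  have hc := rot_rot_ne ht
  have hbc := rot_ne (not_isLeg_rot ht)
  obtain ⟨hs1, hs2, hs3⟩ : F.edge t ≠ t ∧ F.edge t ≠ F.rot t ∧ F.edge t ≠ F.rot (F.rot t) := by
    simpa [AtVertex] using hst
  have eb : F.edge (F.rot t) ≠ t := fun h => hs2 (by rw [← F.edge_edge (F.rot t), h])
  have ec : F.edge (F.rot (F.rot t)) ≠ t := fun h => hs3 (by
    rw [← F.edge_edge (F.rot (F.rot t)), h])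
  have eb' := edge_injective_ne hb
  have ec' := edge_injective_ne hc
  have ebc := edge_injective_ne hbc
  have hz : ∀ x, x ≠ F.edge t → x ≠ t →
      (Pi.single x 1 : F.HalfEdge → ℤ) (F.edge t) + (Pi.single x 1 : F.HalfEdge → ℤ) t = 0 :=
    fun x h1 h2 => by rw [Pi.single_eq_of_ne h1.symm, Pi.single_eq_of_ne h2.symm, add_zero]
  have hr : ∀ x, x ≠ F.edge t → x ≠ t → F.edge x ≠ F.edge t → F.edge x ≠ t →
      (edgeRow x) (F.edge t) + (edgeRow x) t = 0 := fun x h1 h2 h3 h4 => by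
    have := hz x h1 h2
    have := hz (F.edge x) h3 h4
    simp only [edgeRow, Pi.sub_apply]
    omega
  have hN1 : ∀ x, ¬ AtVertex (F.rot t) (F.edge x) → N x (F.edge t) + N x t = 0 := fun x hx =>
    hN x (mt atVertex_rot_left.2 hx)
  have hN2 : ∀ x, ¬ AtVertex (F.rot (F.rot t)) (F.edge x) → N x (F.edge t) + N x t = 0 :=
    fun x hx => hN1 x (mt atVertex_rot_left.2 hx)
  have t1 : vertexDet N t = 0 := by
    have hu : (edgeRow t) (F.edge t) + (edgeRow t) t = 0 := by
      simp [edgeRow, hs1, hs1.symm]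
    rw [vertexDet, det_replaceVertex_eq_zero ht hs1 hN hu (hz _ eb' eb) (hz _ hs2.symm hb),
      det_replaceVertex_eq_zero ht hs1 hN hu (hz _ ec' ec) (hz _ hs3.symm hc), add_zero]
  have t2 : vertexDet N (F.rot t) = 0 := by
    rw [vertexDet, det_replaceVertex_eq_zero (not_isLeg_rot ht) hs1 hN1
      (hr _ hs2.symm hb eb' eb) (hz _ ec' ec) (hz _ hs3.symm hc), zero_add, F.rot_rot_rot]
    refine det_eq_zero_of_eq_sub (i := t) (j := F.edge t) (l := F.edge (F.rot (F.rot t)))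
      hs1.symm ec.symm ?_
    rw [replaceVertex, F.rot_rot_rot, replaceRows_of_ne eb.symm ec.symm hs1.symm,
      replaceRows_right, replaceRows_middle ec', hNt]
  have t3 : vertexDet N (F.rot (F.rot t)) = 0 := by
    rw [vertexDet, F.rot_rot_rot, det_replaceVertex_eq_zero (not_isLeg_rot (not_isLeg_rot ht)) hs1
      hN2 (hr _ hs3.symm hc ec' ec) (hz _ eb' eb) (hz _ hs2.symm hb), add_zero]
    refine det_eq_zero_of_eq_sub (i := t) (j := F.edge (F.rot t)) (l := F.edge t)
      eb.symm hs1.symm ?_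
    rw [replaceVertex, F.rot_rot_rot, replaceRows_of_ne ec.symm hs1.symm eb.symm,
      replaceRows_right, replaceRows_middle eb'.symm, hNt]
  rw [t1, t2, t3]
  rfl

theorem replaceVertex_of_not_atVertex {N : F.HalfEdge → F.HalfEdge → ℤ} {x : F.HalfEdge}
    {u v w : F.HalfEdge → ℤ} (hx : ¬ AtVertex s (F.edge x)) : replaceVertex N s u v w x = N x := by
  refine replaceRows_of_ne ?_ ?_ ?_ <;> rintro rfl <;> exact hx (by simp [AtVertex, F.edge_edge])

theorem replaceVertex_congr {N N' : F.HalfEdge → F.HalfEdge → ℤ} {x : F.HalfEdge}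
    {u v w : F.HalfEdge → ℤ} (hx : ¬ AtVertex s (F.edge x) → N x = N' x) :
    replaceVertex N s u v w x = replaceVertex N' s u v w x := by
  by_cases h : AtVertex s (F.edge x)
  · have h' : x = F.edge s ∨ x = F.edge (F.rot s) ∨ x = F.edge (F.rot (F.rot s)) := by
      rcases h with h | h | h <;> rw [← h, F.edge_edge] <;> simp
    simp only [replaceVertex, replaceRows, Function.update_apply]
    rcases h' with h | h | h <;> simp [h]
  · rw [replaceVertex_of_not_atVertex h, replaceVertex_of_not_atVertex h, hx h]

/-- The partner of a leg is a good base point: its replaced row is never one of the rows belonging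
to a trivalent vertex. -/
theorem cycleRows_edge (ε : F.State) {m a : F.HalfEdge} (hm : F.IsLeg m) (ha : ¬ F.IsLeg a) :
    cycleRows ε.facePerm (F.edge m) (F.edge a) = Pi.single (F.edge a) 1 -
      Pi.single (if ε.val a then F.rot a else F.rot (F.rot a)) 1 := by
  rw [cycleRows, if_neg (edge_injective_ne (by rintro rfl; exact ha hm)),
    State.facePerm_edge_of_not_isLeg ε ha, State.vertexPerm_apply, rot_symm]

theorem cycleRows_toggle (ε : F.State) (hs : ¬ F.IsLeg s) (x₀ : F.HalfEdge) {x : F.HalfEdge}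
    (hx : ¬ AtVertex s (F.edge x)) :
    cycleRows (ε.toggle hs).facePerm x₀ x = cycleRows ε.facePerm x₀ x := by
  rw [cycleRows, cycleRows, State.facePerm_toggle hs ε hx]

theorem cycleRows_add_eq_zero {t : F.HalfEdge} (ht : ¬ F.IsLeg t) (hs : ¬ F.IsLeg (F.edge t))
    (ε : F.State) {m : F.HalfEdge} (hm : F.IsLeg m) {x : F.HalfEdge}
    (hx : ¬ AtVertex t (F.edge x)) (hx' : ¬ AtVertex (F.edge t) (F.edge x)) :
    cycleRows ε.facePerm (F.edge m) x (F.edge t) + cycleRows ε.facePerm (F.edge m) x t = 0 := by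
  have hz : ∀ y, y ≠ F.edge t → y ≠ t →
      (Pi.single y 1 : F.HalfEdge → ℤ) (F.edge t) + (Pi.single y 1 : F.HalfEdge → ℤ) t = 0 :=
    fun y h1 h2 => by rw [Pi.single_eq_of_ne h1.symm, Pi.single_eq_of_ne h2.symm, add_zero]
  rw [cycleRows]
  split_ifs with h
  · refine hz _ (edge_injective_ne (by rintro rfl; exact ht hm)) ?_
    rintro rfl
    rw [F.edge_edge] at hs
    exact hs hm
  · have h1 := hz x (by rintro rfl; exact hx (by rw [F.edge_edge]; exact atVertex_self _))
      (by rintro rfl; exact hx' (atVertex_self _))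
    have h2 := hz (ε.facePerm x) (fun h => hx' (facePerm_eq_of_not_isLeg hs h))
      (fun h => hx (facePerm_eq_of_not_isLeg ht h))
    simp only [Pi.sub_apply]
    omega

/-- Once the row of the edge joining the two vertices is the edge row, the ordering at `t` no longer
matters: the difference of its two orderings is a sum killed by `vertexDet_sum_eq_zero`. -/
theorem vertexDet_cycleRows_toggle {t : F.HalfEdge} (ht : ¬ F.IsLeg t) (hs : ¬ F.IsLeg (F.edge t))
    (hst : ¬ AtVertex t (F.edge t)) (ε : F.State) {m : F.HalfEdge} (hm : F.IsLeg m) :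
    vertexDet (cycleRows ε.facePerm (F.edge m)) (F.edge t) =
      vertexDet (cycleRows (ε.toggle ht).facePerm (F.edge m)) (F.edge t) := by
  have hts : ¬ AtVertex (F.edge t) t := fun h => hst h.symm
  have hdisj : ∀ {a}, AtVertex t a → ¬ AtVertex (F.edge t) a := fun h1 h2 =>
    hst (h1.trans h2.symm)
  have d1 := edge_injective_ne (rot_ne hs).symm
  have d2 := edge_injective_ne (rot_rot_ne hs).symm
  have d3 := edge_injective_ne (rot_ne (not_isLeg_rot hs)).symm
  obtain ⟨n1, n2, n3⟩ : t ≠ F.edge t ∧ t ≠ F.rot (F.edge t) ∧ t ≠ F.rot (F.rot (F.edge t)) := by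
    simpa [AtVertex] using hts
  have hz : ∀ y, y ≠ F.edge t → y ≠ t →
      (Pi.single y 1 : F.HalfEdge → ℤ) (F.edge t) + (Pi.single y 1 : F.HalfEdge → ℤ) t = 0 :=
    fun y h1 h2 => by rw [Pi.single_eq_of_ne h1.symm, Pi.single_eq_of_ne h2.symm, add_zero]
  have main : ∀ ε : F.State, ε.val t = true →
      vertexDet (cycleRows ε.facePerm (F.edge m)) (F.edge t) =
        vertexDet (cycleRows (ε.toggle ht).facePerm (F.edge m)) (F.edge t) := by
    intro ε hε
    have key : ∀ v w : F.HalfEdge → ℤ, v (F.edge t) + v t = 0 → w (F.edge t) + w t = 0 →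
        Matrix.detRowAlternating (replaceVertex (cycleRows ε.facePerm (F.edge m)) (F.edge t)
          (edgeRow (F.edge t)) v w) =
        Matrix.detRowAlternating (replaceVertex (cycleRows (ε.toggle ht).facePerm (F.edge m))
          (F.edge t) (edgeRow (F.edge t)) v w) := by
      intro v w hv hw
      -- The local formula is applied at `t` to the matrix whose rows at the other end are already
      -- replaced; the two vertices being distinct, the row sets are disjoint.
      rw [← sub_eq_zero, det_vertex_sub ht (N := replaceVertex (cycleRows ε.facePerm (F.edge m))
        (F.edge t) (edgeRow (F.edge t)) v w) (fun _ _ => rfl)]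
      · apply vertexDet_sum_eq_zero ht hst
        · intro x hx
          by_cases hx' : AtVertex (F.edge t) (F.edge x)
          · have h' : x = F.edge (F.edge t) ∨ x = F.edge (F.rot (F.edge t)) ∨
                x = F.edge (F.rot (F.rot (F.edge t))) := by
              simpa only [AtVertex, ← F.edge_symm, Equiv.symm_apply_eq] using hx'
            rcases h' with rfl | rfl | rfl
            · rw [replaceVertex, replaceRows_left d1 d2, edgeRow, F.edge_edge]
              simp [n1, n1.symm]
            · rw [replaceVertex, replaceRows_middle d3, hv]
            · rw [replaceVertex, replaceRows_right, hw]
          · rw [replaceVertex_of_not_atVertex hx']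
            exact cycleRows_add_eq_zero ht hs ε hm hx hx'
        · have : replaceVertex (cycleRows ε.facePerm (F.edge m)) (F.edge t)
              (edgeRow (F.edge t)) v w (F.edge (F.edge t)) = edgeRow (F.edge t) :=
            replaceRows_left d1 d2
          rw [F.edge_edge] at this
          rw [this, edgeRow, F.edge_edge]
      · intro x hx
        exact replaceVertex_congr fun _ => cycleRows_toggle ε ht _ hx
      · intro h hh
        rw [replaceVertex_of_not_atVertex (by rw [F.edge_edge]; exact hdisj hh),
          cycleRows_edge ε hm (mt hh.isLeg_iff.1 ht), ε.val_eq_of_atVertex hh, hε]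
        simp
      · intro h hh
        rw [replaceVertex_of_not_atVertex (by rw [F.edge_edge]; exact hdisj hh),
          cycleRows_edge _ hm (mt hh.isLeg_iff.1 ht), State.toggle_val_of_atVertex ht ε hh,
          ε.val_eq_of_atVertex hh, hε]
        simp
    have e1 := rot_ne hs
    have e2 := rot_rot_ne hs
    have e3 : ∀ y, y ≠ F.edge t → F.edge y ≠ t := fun y h1 h2 => h1 (by rw [← h2, F.edge_edge])
    have e4 : ∀ y, t ≠ y → F.edge y ≠ F.edge t := fun y h => edge_injective_ne h.symm
    rw [vertexDet, vertexDet,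
      key _ _ (hz _ (e4 _ n2) (e3 _ e1)) (hz _ e1 n2.symm),
      key _ _ (hz _ (e4 _ n3) (e3 _ e2)) (hz _ e2 n3.symm)]
  cases hε : ε.val t
  · rw [main (ε.toggle ht), State.toggle_toggle]
    rw [State.toggle_val_of_atVertex ht _ (atVertex_self t), hε]
    rfl
  · exact main ε hε

/-- Reversing the vertex of `t` changes the sign of the state and nothing else in the summand, so
the terms cancel in pairs. -/
theorem sum_vertexDet_eq_zero {t r : F.HalfEdge} (ht : ¬ F.IsLeg t) (hs : ¬ F.IsLeg (F.edge t))
    (hst : ¬ AtVertex t (F.edge t)) (hr : AtVertex (F.edge t) r) {m : F.HalfEdge}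
    (hm : F.IsLeg m) :
    ∑ ε : F.State, ε.sign * (if ε.val r then 1 else -1) *
      vertexDet (cycleRows ε.facePerm (F.edge m)) (F.edge t) = 0 := by
  have h2 := State.two_mul_sum ht fun ε : F.State => ε.sign * (if ε.val r then 1 else -1) *
      vertexDet (cycleRows ε.facePerm (F.edge m)) (F.edge t)
  have hr' : ¬ AtVertex t r := fun h => hst (h.trans hr.symm)
  simp only [State.sign_toggle, State.toggle_val_of_not_atVertex ht _ hr',
    ← vertexDet_cycleRows_toggle ht hs hst _ hm, neg_mul, add_neg_cancel,
    Finset.sum_const_zero] at h2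
  omega

theorem single_sub_single_toggle (hs : ¬ F.IsLeg s) (ε : F.State) {m : F.HalfEdge}
    (hm : F.IsLeg m) :
    ε.single - (ε.toggle hs).single = (if ε.val s then 1 else -1) *
      (vertexDet (cycleRows ε.facePerm (F.edge m)) s +
        vertexDet (cycleRows ε.facePerm (F.edge m)) (F.rot s) +
          vertexDet (cycleRows ε.facePerm (F.edge m)) (F.rot (F.rot s))) := by
  have hv : ∀ {a}, AtVertex s a → (ε.toggle hs).val a = !ε.val s := fun h => by
    rw [State.toggle_val_of_atVertex hs ε h, ε.val_eq_of_atVertex h]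
  rw [State.single_eq_det ε (F.edge m), State.single_eq_det _ (F.edge m)]
  cases hε : ε.val s
  · rw [← neg_sub, det_vertex_sub hs (N := cycleRows ε.facePerm (F.edge m))
      (fun x hx => cycleRows_toggle ε hs _ hx) (fun _ _ => rfl)]
    · simp
    · intro h hh
      rw [cycleRows_edge _ hm (mt hh.isLeg_iff.1 hs), hv hh, hε]
      simp
    · intro h hh
      rw [cycleRows_edge _ hm (mt hh.isLeg_iff.1 hs), ε.val_eq_of_atVertex hh, hε]
      simp
  · rw [det_vertex_sub hs (N := cycleRows ε.facePerm (F.edge m)) (fun _ _ => rfl)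
      (fun x hx => cycleRows_toggle ε hs _ hx)]
    · simp
    · intro h hh
      rw [cycleRows_edge _ hm (mt hh.isLeg_iff.1 hs), ε.val_eq_of_atVertex hh, hε]
      simp
    · intro h hh
      rw [cycleRows_edge _ hm (mt hh.isLeg_iff.1 hs), hv hh, hε]
      simp

end

/-- With either ordering, one side of the loop is a closed curve of length one. -/
theorem State.single_eq_zero_of_loop (ε : F.State) {a : F.HalfEdge} (ha : ¬ F.IsLeg a)
    (hloop : F.edge a = F.rot a) : ε.single = 0 := by
  have hfix : ∃ p, ε.facePerm p = p := by
    cases hε : ε.val a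
    · refine ⟨a, ?_⟩
      have h1 : a = F.edge (F.rot a) := by rw [← hloop, F.edge_edge]
      conv_lhs => rw [h1]
      rw [facePerm_edge_of_not_isLeg ε (not_isLeg_rot ha), vertexPerm_apply, ε.rot_apply, hε]
      simp
    · refine ⟨F.rot a, ?_⟩
      conv_lhs => rw [← hloop]
      rw [facePerm_edge_of_not_isLeg ε ha, vertexPerm_apply, hε]
      simp
  obtain ⟨p, hp⟩ := hfix
  obtain ⟨q, hq⟩ : ∃ q, q ≠ p := by
    by_cases h : a = p
    · exact ⟨F.rot a, fun h' => ha (h'.trans h.symm)⟩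
    · exact ⟨a, h⟩
  refine if_neg (not_isTransitive_of_invariant (· = p) ?_ ?_ rfl hq)
  · rintro x rfl; exact hp
  · intro x hx; exact ε.facePerm.injective (hx.trans hp.symm)

/-- The diagrams in which a trivalent vertex has no leg as a neighbour. -/
theorem weight_eq_zero_of_neighbors {s : F.HalfEdge}
    (hs : ¬ F.IsLeg s) (h : ∀ a, AtVertex s a → ¬ F.IsLeg (F.edge a)) : F.weight = 0 := by
  classical
  -- The cancellation needs the two ends of each edge at distinct vertices, so loops are treated
  -- separately.
  by_cases hloop : ∃ a, ¬ F.IsLeg a ∧ F.edge a = F.rot a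
  · obtain ⟨a, ha, ha'⟩ := hloop
    exact Finset.sum_eq_zero fun ε _ => by rw [ε.single_eq_zero_of_loop ha ha', mul_zero]
  push Not at hloop
  obtain ⟨m, hm, -⟩ := F.exists_leg s
  have hm : F.IsLeg m := hm
  have hsum : ∀ a, AtVertex s a → ∑ ε : F.State, ε.sign * (if ε.val s then 1 else -1) *
      vertexDet (cycleRows ε.facePerm (F.edge m)) a = 0 := by
    intro a ha
    have hal : ¬ F.IsLeg a := mt ha.isLeg_iff.1 hs
    have hst : ¬ AtVertex (F.edge a) (F.edge (F.edge a)) := by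
      rw [F.edge_edge]
      intro h1
      rcases h1.symm with h2 | h2 | h2
      · exact F.edge_ne a h2
      · exact hloop a hal h2
      · refine hloop _ (h a ha) ?_
        rw [F.edge_edge, h2, F.rot_rot_rot]
    have := sum_vertexDet_eq_zero (t := F.edge a) (r := s) (h a ha) (by rwa [F.edge_edge]) hst
      (by rw [F.edge_edge]; exact ha.symm) hm
    rwa [F.edge_edge] at this
  have h2 := State.two_mul_sum hs fun ε : F.State => ε.sign * ε.single
  have h3 : ∀ ε : F.State, ε.sign * ε.single + (ε.toggle hs).sign * (ε.toggle hs).single =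
      ε.sign * (if ε.val s then 1 else -1) * vertexDet (cycleRows ε.facePerm (F.edge m)) s +
      ε.sign * (if ε.val s then 1 else -1) *
        vertexDet (cycleRows ε.facePerm (F.edge m)) (F.rot s) +
      ε.sign * (if ε.val s then 1 else -1) *
        vertexDet (cycleRows ε.facePerm (F.edge m)) (F.rot (F.rot s)) := by
    intro ε
    rw [State.sign_toggle, neg_mul, ← sub_eq_add_neg, ← mul_sub,
      single_sub_single_toggle hs ε hm]
    ring
  rw [Finset.sum_congr rfl fun ε _ => h3 ε, Finset.sum_add_distrib, Finset.sum_add_distrib,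
    hsum _ (Or.inl rfl), hsum _ (Or.inr (Or.inl rfl)), hsum _ (Or.inr (Or.inr rfl))] at h2
  unfold weight
  omega

/-- If there are more trivalent vertices than legs, some trivalent vertex has no leg as a
neighbour. -/
theorem weight_eq_zero_of_numLegs_lt (hF : F.numLegs < n) : F.weight = 0 := by
  classical
  by_contra hw
  have h1 : ∀ s, ¬ F.IsLeg s → ∃ a, AtVertex a s ∧ F.IsLeg (F.edge a) := by
    intro s hs
    by_contra! h
    exact hw (weight_eq_zero_of_neighbors hs fun a ha => h a ha.symm)
  let f : {l // F.IsLeg l} × Fin 3 → F.HalfEdge := fun p =>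
    ![F.edge p.1.1, F.rot (F.edge p.1.1), F.rot (F.rot (F.edge p.1.1))] p.2
  -- If every trivalent vertex had a leg as a neighbour, each leg would account for itself and for
  -- three half-edges. Four half-edges per leg are too few against `card_halfEdge_add`.
  let g : {l // F.IsLeg l} ⊕ {l // F.IsLeg l} × Fin 3 → F.HalfEdge := Sum.elim Subtype.val f
  have hg : Function.Surjective g := by
    intro s
    by_cases hs : F.IsLeg s
    · exact ⟨Sum.inl ⟨s, hs⟩, rfl⟩
    · obtain ⟨a, ha, hl⟩ := h1 s hs
      rcases ha with h | h | h
      · exact ⟨Sum.inr (⟨F.edge a, hl⟩, 0), by simp [g, f, h, F.edge_edge]⟩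
      · exact ⟨Sum.inr (⟨F.edge a, hl⟩, 1), by simp [g, f, h, F.edge_edge]⟩
      · exact ⟨Sum.inr (⟨F.edge a, hl⟩, 2), by simp [g, f, h, F.edge_edge]⟩
  have h2 := Nat.card_le_card_of_surjective g hg
  rw [Nat.card_sum, Nat.card_prod, Nat.card_fin] at h2
  have h3 := F.card_halfEdge_add
  change Nat.card F.HalfEdge ≤ F.numLegs + F.numLegs * 3 at h2
  omega

end FeynmanDiagram

/-! ### Parities of distances along a cyclic order -/

section Rotation

variable {I : Type*} [Finite I] {r : Equiv.Perm I}

/-- `N i` is the parity of the distance from `i` forwards to the nearest `false`, which is zero if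
`i` itself is `false`. -/
theorem exists_parity_next (hr : IsTransitive r) {u : I → Bool} (hu : ∃ i, u i = false) :
    ∃ N : I → Bool, ∀ i, (u i = false → N i = false) ∧ (u i = true → N i = !N (r i)) := by
  obtain ⟨i₀, hi₀⟩ := hu
  have hex : ∀ i, ∃ m : ℕ, u ((r ^ m) i) = false := fun i => by
    obtain ⟨m, _, hm⟩ := (hr i i₀).exists_pow_eq'
    exact ⟨m, by rw [hm, hi₀]⟩
  refine ⟨fun i => (Nat.find (hex i)).bodd, fun i => ⟨fun h => ?_, fun h => ?_⟩⟩
  · have : Nat.find (hex i) = 0 := (Nat.find_eq_zero _).2 h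
    simp [this]
  · have h1 : Nat.find (hex i) = Nat.find (hex (r i)) + 1 := by
      refine Nat.find_comp_succ (hex i) (hex (r i)) ?_ |>.trans ?_
      · simp [h]
      · rfl
    change (Nat.find (hex i)).bodd = !(Nat.find (hex (r i))).bodd
    rw [h1, Nat.bodd_succ]

/-- `P i` is the parity of the distance back to the last `false` strictly before `i`. It comes from
the forward parity for the inverse rotation; the negation accounts for the strictness. -/
theorem exists_parity_prev (hr : IsTransitive r) {u : I → Bool} (hu : ∃ i, u i = false) :
    ∃ P : I → Bool, ∀ i, (u i = false → P (r i) = true) ∧ (u i = true → P (r i) = !P i) := by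
  have hr' : IsTransitive r⁻¹ := fun x y => Equiv.Perm.sameCycle_inv.2 (hr x y)
  obtain ⟨N, hN⟩ := exists_parity_next hr' hu
  refine ⟨fun i => !N (r⁻¹ i), fun i => ⟨fun h => ?_, fun h => ?_⟩⟩
  · simp [(hN i).1 h]
  · have := (hN i).2 h
    simp_all

end Rotation

/-! ### Boundary curves of the wheel -/

section Wheel

open FeynmanDiagram

variable {n : ℕ}

/-- The states of the wheel: a cyclic ordering at each inner vertex. -/
def wheelState (n : ℕ) : (wheel n).State ≃ (Fin n → Bool) where
  toFun ε i := ε.val ((i, .inner) : Fin n × WheelEnd)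
  invFun u :=
    { val := fun h : Fin n × WheelEnd => match h with
        | (_, .outer) => false
        | (i, .inner) => u i
        | (i, .fwd) => u i
        | (i, .bwd) => u i
      val_rot := by rintro ⟨i, _ | _ | _ | _⟩ <;> rfl
      val_of_isLeg := by
        rintro ⟨i, _ | _ | _ | _⟩ h
        · rfl
        all_goals
          have h : wheelRot n _ = _ := h
          simp [wheelRot] at h }
  left_inv ε := by
    refine State.ext ?_
    have h1 : ∀ i : Fin n, ε.val ((i, .fwd) : Fin n × WheelEnd) =
        ε.val ((i, .inner) : Fin n × WheelEnd) := fun i => ε.val_rot (i, .inner)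
    have h2 : ∀ i : Fin n, ε.val ((i, .bwd) : Fin n × WheelEnd) =
        ε.val ((i, .fwd) : Fin n × WheelEnd) := fun i => ε.val_rot (i, .fwd)
    rintro ⟨i, _ | _ | _ | _⟩
    · have hl : (wheel n).IsLeg ((i, .outer) : Fin n × WheelEnd) := rfl
      exact (ε.of_isLeg hl).symm
    · rfl
    · exact (h1 i).symm
    · exact ((h2 i).trans (h1 i)).symm
  right_inv u := rfl

/-- The boundary curves of a state of the wheel. -/
def wheelFace (u : Fin n → Bool) : Equiv.Perm (Fin n × WheelEnd) :=
  ((wheelState n).symm u).facePerm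

variable (u : Fin n → Bool) (i : Fin n)

theorem wheelFace_outer : wheelFace u (i, .outer) = if u i then (i, .fwd) else (i, .bwd) := by
  cases h : u i <;>
  · change wheelWilson n (if u i then wheelRot n (i, .inner) else (wheelRot n).symm (i, .inner)) = _
    rw [h]
    rfl

theorem wheelFace_inner : wheelFace u (i, .inner) = (finRotate n i, .outer) := rfl

theorem wheelFace_fwd : wheelFace u (i, .fwd) =
    if u (finRotate n i) then (finRotate n i, .inner) else (finRotate n i, .fwd) := by
  cases h : u (finRotate n i) <;>
  · change wheelWilson n (if u (finRotate n i) then wheelRot n (finRotate n i, .bwd)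
      else (wheelRot n).symm (finRotate n i, .bwd)) = _
    rw [h]
    rfl

theorem wheelFace_bwd : wheelFace u (finRotate n i, .bwd) =
    if u i then (i, .bwd) else (i, .inner) := by
  have h1 : ∀ j, wheelFace u (j, .bwd) = wheelWilson n (if u ((finRotate n).symm j)
      then wheelRot n ((finRotate n).symm j, .fwd)
      else (wheelRot n).symm ((finRotate n).symm j, .fwd)) := fun _ => rfl
  rw [h1, Equiv.symm_apply_apply]
  cases u i <;> rfl

variable {u}

/-- This state is the planar drawing, where the inner side of the rim is a curve of its own. -/
theorem not_isTransitive_wheelFace_of_forall (hn : 0 < n) (hu : ∀ i, u i = true) :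
    ¬ IsTransitive (wheelFace u) := by
  have key : ∀ x : Fin n × WheelEnd, (wheelFace u x).2 = .bwd ↔ x.2 = .bwd := by
    rintro ⟨i, _ | _ | _ | _⟩
    · simp [wheelFace_outer, hu]
    · simp [wheelFace_inner]
    · simp [wheelFace_fwd, hu]
    · obtain ⟨i, rfl⟩ := (finRotate n).surjective i
      rw [wheelFace_bwd, hu]
      simp
  exact not_isTransitive_of_invariant (fun x => x.2 = .bwd) (fun x => (key x).2)
    (fun x => (key x).1) (a := (⟨0, hn⟩, .bwd)) (b := (⟨0, hn⟩, .fwd)) rfl (by simp)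

/-- A colouring of the spokes with alternating colours. -/
def IsAlternating (c : Fin n → Bool) : Prop := ∀ i, c (finRotate n i) = !c i

/-- `N i` and `P i` differ exactly when the gap between consecutive reversed spokes around `i` has
odd length. If no gap were odd, `N` would be an alternating colouring. -/
theorem not_isTransitive_wheelFace (hr : IsTransitive (finRotate n)) (hu : ∃ i, u i = false)
    (hc : ¬ ∃ c, IsAlternating c ∧ ∀ i, u i = false → c i = false) :
    ¬ IsTransitive (wheelFace u) := by
  obtain ⟨N, hN⟩ := exists_parity_next hr hu
  obtain ⟨P, hP⟩ := exists_parity_prev hr hu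
  obtain ⟨i₀, hi₀⟩ : ∃ i, N i ≠ P i := by
    by_contra! h
    refine hc ⟨N, fun i => ?_, fun i => (hN i).1⟩
    cases hi : u i
    · rw [h, (hP i).1 hi, (hN i).1 hi]; rfl
    · rw [(hN i).2 hi, Bool.not_not]
  obtain ⟨i₁, hi₁⟩ := hu
  -- A union of curves confined to the odd gaps: all backward rim ends there, and the forward route
  -- along spokes at even distance from the end of the gap. It is nonempty, and it omits the forward
  -- end at any reversed spoke.
  let Q : Fin n × WheelEnd → Prop := fun x => match x with
    | (i, .outer) => N i ≠ P i ∧ N i = false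
    | (i, .inner) => N (finRotate n i) ≠ P (finRotate n i) ∧ N (finRotate n i) = false
    | (i, .fwd) => u i = true ∧ N i ≠ P i ∧ N i = false
    | (i, .bwd) => N i ≠ P i
  have key : ∀ x, Q (wheelFace u x) ↔ Q x := by
    rintro ⟨i, _ | _ | _ | _⟩
    · have h1 := hN i
      rw [wheelFace_outer]
      cases h : u i <;> simp_all [Q]
    · rfl
    · rw [wheelFace_fwd]
      have h1 := hN i
      have h2 := hN (finRotate n i)
      have h3 := hP i
      have h4 := hP (finRotate n i)
      cases h : u i <;> cases h' : u (finRotate n i) <;>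
        simp only [h, h', Q, forall_const, true_and, and_true, Bool.false_eq_true, if_true, if_false,
          false_imp_iff, reduceCtorEq, false_and] at * <;> clear hN hP hc <;> grind
    · obtain ⟨i, rfl⟩ := (finRotate n).surjective i
      rw [wheelFace_bwd]
      have h1 := hN i
      have h3 := hP i
      clear hN hP hc
      cases h : u i <;> cases hN : N i <;> cases hP : P i <;> simp_all [Q]
  exact not_isTransitive_of_invariant Q (fun x => (key x).2) (fun x => (key x).1)
    (a := (i₀, .bwd)) (b := (i₁, .fwd)) hi₀ (by simp [Q, hi₁])

/-- All curves are linked to the outer ends of the spokes coloured `true`, and these are linked to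
one another by steps of two. -/
theorem isTransitive_wheelFace (hr : IsTransitive (finRotate n)) (hu : ∃ i, u i = false)
    {c : Fin n → Bool} (hc : IsAlternating c) (huc : ∀ i, u i = false → c i = false) :
    IsTransitive (wheelFace u) := by
  obtain ⟨i₀, hi₀⟩ := hu
  set r := finRotate n with hr_def
  set R := (wheelFace u).SameCycle with hR
  have step : ∀ {x y}, wheelFace u x = y → R x y := fun h => ⟨1, h⟩
  have trans : ∀ {x y z}, R x y → R y z → R x z := fun h1 h2 => h1.trans h2
  have symm : ∀ {x y}, R x y → R y x := fun h => h.symm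
  have odd : ∀ {i}, c i = true → u i = true := fun {i} h => by
    by_contra h'
    rw [huc i (by simpa using h')] at h
    exact Bool.false_ne_true h
  have c1 : ∀ {i}, c i = false → c (r i) = true := fun {i} h => by rw [hc i, h]; rfl
  have c2 : ∀ {i}, c i = true → c (r i) = false := fun {i} h => by rw [hc i, h]; rfl
  have hin : ∀ i, R (i, .inner) (r i, .outer) := fun i => step (wheelFace_inner u i)
  have hot : ∀ {i}, u i = true → R (i, .outer) (i, .fwd) := fun {i} h =>
    step (by rw [wheelFace_outer, h]; rfl)
  have hof : ∀ {i}, u i = false → R (i, .outer) (i, .bwd) := fun {i} h =>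
    step (by rw [wheelFace_outer, h]; rfl)
  have hft : ∀ {i}, u (r i) = true → R (i, .fwd) (r (r i), .outer) := fun {i} h =>
    trans (step (by rw [wheelFace_fwd, h]; rfl)) (hin (r i))
  have hff : ∀ {i}, u (r i) = false → R (i, .fwd) (r i, .fwd) := fun {i} h =>
    step (by rw [wheelFace_fwd, h]; rfl)
  have hbt : ∀ {i}, u i = true → R (r i, .bwd) (i, .bwd) := fun {i} h =>
    step (by rw [wheelFace_bwd, h]; rfl)
  have hbf : ∀ {i}, u i = false → R (r i, .bwd) (r i, .outer) := fun {i} h =>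
    trans (step (by rw [wheelFace_bwd, h]; rfl)) (hin i)
  have hpow : ∀ (m : ℕ) (i : Fin n), (r ^ (m + 1)) i = (r ^ m) (r i) := fun m i => by
    rw [pow_succ, Equiv.Perm.mul_apply]
  have hpow' : ∀ (m : ℕ) (i : Fin n), (r ^ (m + 1)) i = r ((r ^ m) i) := fun m i => by
    rw [pow_succ', Equiv.Perm.mul_apply]
  have hreach : ∀ i j, ∃ m : ℕ, (r ^ m) i = j := fun i j => by
    obtain ⟨m, _, hm⟩ := (hr i j).exists_pow_eq'
    exact ⟨m, hm⟩
  -- From an outer end coloured `false`, the curve advances by twos until it meets a reversed spoke,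
  -- where it turns and returns along the inner side of the rim.
  have turn' : ∀ (m : ℕ) i, c i = false → u ((r ^ m) i) = false →
      R (i, .outer) (i, .bwd) := by
    intro m
    induction m using Nat.twoStepInduction with
    | zero => intro i _ h; exact hof h
    | one =>
      intro i h1 h2
      have h2 : u (r i) = false := h2
      rw [odd (c1 h1)] at h2
      exact absurd h2 (by simp)
    | more m ih _ =>
      intro i h1 h2
      cases hi : u i
      · exact hof hi
      · rw [hpow, hpow] at h2
        have h3 := odd (c1 h1)
        exact trans (hot hi) (trans (hft h3) (trans (ih _ (c2 (c1 h1)) h2)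
          (trans (hbt h3) (hbt hi))))
  have turn : ∀ {i}, c i = false → R (i, .outer) (i, .bwd) := fun {i} h => by
    obtain ⟨m, hm⟩ := hreach i i₀
    exact turn' m i h (by rw [hm, hi₀])
  -- If the spoke in between is reversed, the curve overshoots by one to the other colour, turns
  -- back by `turn`, and leaves the inner side at that reversed spoke.
  have hop : ∀ {i}, c i = true → R (i, .outer) (r (r i), .outer) := by
    intro i h
    cases hi : u (r i)
    · have h3 := odd (c1 (c2 h))
      exact trans (hot (odd h)) (trans (hff hi) (trans (hft h3) (trans (turn (c2 (c1 (c2 h))))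
        (trans (hbt h3) (hbf hi)))))
    · exact trans (hot (odd h)) (hft hi)
  have odd_outer : ∀ (m : ℕ) i, c i = true → c ((r ^ m) i) = true →
      R (i, .outer) ((r ^ m) i, .outer) := by
    intro m
    induction m using Nat.twoStepInduction with
    | zero => intro i _ _; exact Equiv.Perm.SameCycle.refl _ _
    | one =>
      intro i h1 h2
      have h2 : c (r i) = true := h2
      rw [c2 h1] at h2
      exact absurd h2 (by simp)
    | more m ih _ =>
      intro i h1 h2
      rw [hpow, hpow] at h2 ⊢
      exact trans (hop h1) (ih _ (c1 (c2 h1)) h2)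
  -- Running past a reversed spoke shifts the forward route from one colour to the other; this
  -- connects the two classes.
  have pass : ∀ {i}, u i = false → ∃ o, c o = true ∧ R (r (r i), .outer) (o, .outer) := by
    intro i h
    obtain ⟨o, rfl⟩ := r.surjective i
    have ho : c o = true := by
      have h1 := hc o
      rw [huc _ h] at h1
      simpa using h1.symm
    exact ⟨o, ho, symm (trans (hot (odd ho)) (trans (hff h) (hft (odd (c1 (c2 ho))))))⟩
  have even_outer : ∀ (m : ℕ), c ((r ^ m) (r (r i₀))) = false →
      ∃ o, c o = true ∧ R ((r ^ m) (r (r i₀)), .outer) (o, .outer) := by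
    intro m
    induction m using Nat.twoStepInduction with
    | zero => intro _; exact pass hi₀
    | one =>
      intro h
      have h : c (r (r (r i₀))) = false := h
      rw [c1 (c2 (c1 (huc _ hi₀)))] at h
      exact absurd h (by simp)
    | more m ih _ =>
      intro h
      rw [hpow', hpow'] at h ⊢
      generalize (r ^ m) (r (r i₀)) = i at ih h
      have hi : c i = false := by
        cases hi : c i
        · rfl
        · rw [c1 (c2 hi)] at h
          exact absurd h (by simp)
      cases hui : u i
      · exact pass hui
      · obtain ⟨o, ho, h1⟩ := ih hi
        exact ⟨o, ho, trans (symm (trans (hot hui) (hft (odd (c1 hi))))) h1⟩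
  have outer : ∀ i, ∃ o, c o = true ∧ R (i, .outer) (o, .outer) := by
    intro i
    cases hi : c i
    · obtain ⟨m, hm⟩ := hreach (r (r i₀)) i
      rw [← hm] at hi ⊢
      exact even_outer m hi
    · exact ⟨i, hi, Equiv.Perm.SameCycle.refl _ _⟩
  have all_outer : ∀ i j, R (i, .outer) (j, .outer) := by
    intro i j
    obtain ⟨o, ho, h1⟩ := outer i
    obtain ⟨o', ho', h2⟩ := outer j
    obtain ⟨m, rfl⟩ := hreach o o'
    exact trans h1 (trans (odd_outer m o ho ho') (symm h2))
  have all : ∀ x, ∃ j, R x (j, .outer) := by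
    rintro ⟨i, _ | _ | _ | _⟩
    · exact ⟨i, Equiv.Perm.SameCycle.refl _ _⟩
    · exact ⟨r i, hin i⟩
    · cases hi : c i
      · exact ⟨_, hft (odd (c1 hi))⟩
      · exact ⟨i, symm (hot (odd hi))⟩
    · obtain ⟨i, rfl⟩ := r.surjective i
      cases hi : c i
      · cases hui : u i
        · exact ⟨_, hbf hui⟩
        · exact ⟨_, trans (hbt hui) (symm (turn hi))⟩
      · exact ⟨_, symm (turn (c2 hi))⟩
  intro x y
  obtain ⟨i, hi⟩ := all x
  obtain ⟨j, hj⟩ := all y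
  exact trans hi (trans (all_outer i j) (symm hj))

theorem isTransitive_finRotate (m : ℕ) : IsTransitive (finRotate (m + 2)) := fun x y => by
  have h : ∀ x, finRotate (m + 2) x ≠ x := fun x => by
    rw [← Equiv.Perm.mem_support, support_finRotate]
    exact Finset.mem_univ x
  exact isCycle_finRotate.sameCycle (h x) (h y)

theorem IsAlternating.apply_eq {m : ℕ} {c : Fin (m + 1) → Bool} (hc : IsAlternating c) :
    ∀ (k : ℕ) (hk : k < m + 1), c ⟨k, hk⟩ = xor (c 0) k.bodd := by
  intro k
  induction k with
  | zero => intro hk; simp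
  | succ k ih =>
    intro hk
    have h1 := hc ⟨k, by omega⟩
    rw [finRotate_of_lt (by omega), ih] at h1
    rw [h1, Nat.bodd_succ]
    cases c 0 <;> simp

theorem IsAlternating.even {m : ℕ} {c : Fin (m + 1) → Bool} (hc : IsAlternating c) :
    Even (m + 1) := by
  have h1 := hc (Fin.last m)
  rw [finRotate_last, Fin.last, hc.apply_eq m] at h1
  rw [← Nat.not_odd_iff_even, Nat.odd_add_one, not_not, ← Nat.not_even_iff_odd]
  intro h2
  rw [Nat.even_iff, Nat.mod_two_of_bodd] at h2
  have h0 : c ⟨0, by omega⟩ = c 0 := rfl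
  cases h3 : m.bodd <;> cases h4 : c 0 <;> simp_all

theorem isAlternating_xor_bodd {m : ℕ} (hm : Even (m + 1)) (b : Bool) :
    IsAlternating (fun i : Fin (m + 1) => xor b i.val.bodd) := by
  intro i
  obtain h | h := Nat.lt_or_ge i.val m
  · have h1 := finRotate_of_lt h
    have h2 : (⟨i.val, by omega⟩ : Fin (m + 1)) = i := rfl
    rw [h2] at h1
    rw [h1]
    simp
  · obtain rfl : i = Fin.last m := Fin.ext (by simp; omega)
    rw [finRotate_last]
    have : m.bodd = true := by
      have h1 : (m + 1) % 2 = 0 := Nat.even_iff.1 hm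
      rw [Nat.mod_two_of_bodd, Nat.bodd_succ] at h1
      cases h : m.bodd <;> simp_all
    simp [this]

end Wheel

/-! ### The signed count for the wheel -/

section Wheel

open FeynmanDiagram

theorem wheelState_symm_sign {n : ℕ} (u : Fin n → Bool) :
    ((wheelState n).symm u).sign = ∏ i, if u i then -1 else 1 := by
  have h1 : ((wheelState n).symm u).sign = ∏ x : Fin n × WheelEnd,
      if ((wheelState n).symm u).val x then (-1 : ℤ) else 1 := by
    have h2 : (wheel n).fintypeHalfEdge = inferInstanceAs (Fintype (Fin n × WheelEnd)) :=
      Subsingleton.elim _ _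
    rw [State.sign, h2]
    rfl
  rw [h1, Fintype.prod_prod_type]
  refine Finset.prod_congr rfl fun i _ => ?_
  change ∏ s ∈ ({.outer, .inner, .fwd, .bwd} : Finset WheelEnd), _ = _
  simp only [Finset.prod_insert, Finset.mem_insert, Finset.mem_singleton, reduceCtorEq, or_self,
    not_false_eq_true, Finset.prod_singleton]
  change (1 : ℤ) * ((if u i then -1 else 1) * ((if u i then -1 else 1) *
    (if u i then -1 else 1))) = _
  cases u i <;> simp

theorem weight_wheel {n : ℕ} : (wheel n).weight =
    ∑ u : Fin n → Bool, (∏ i, if u i then -1 else 1) * ((wheelState n).symm u).single := by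
  refine Fintype.sum_equiv (wheelState n) _ _ fun ε => ?_
  rw [← wheelState_symm_sign, Equiv.symm_apply_apply]

theorem wheel_single_eq_zero {n : ℕ} {u : Fin n → Bool} (h : ¬ IsTransitive (wheelFace u)) :
    ((wheelState n).symm u).single = 0 := if_neg h

theorem wheel_single_eq_one {n : ℕ} {u : Fin n → Bool} (h : IsTransitive (wheelFace u)) :
    ((wheelState n).symm u).single = 1 := if_pos h

theorem weight_wheel_of_odd {m : ℕ} (hm : Odd (m + 2)) : (wheel (m + 2)).weight = 0 := by
  rw [weight_wheel]
  refine Finset.sum_eq_zero fun u _ => ?_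
  rw [wheel_single_eq_zero, mul_zero]
  by_cases hu : ∀ i, u i = true
  · exact not_isTransitive_wheelFace_of_forall (by omega) hu
  · push Not at hu
    refine not_isTransitive_wheelFace (isTransitive_finRotate m) (by simpa using hu) ?_
    rintro ⟨c, hc, -⟩
    exact Nat.not_even_iff_odd.2 hm hc.even

/-- Each of the first two products tests whether the reversed spokes lie in one parity class. Both
accept the state without reversed spokes, which has several curves, whence the correction by `2`.
Products over spokes make the later sum over states factor. -/
theorem wheel_single_of_even {m : ℕ} (hm : Even (m + 2)) (u : Fin (m + 2) → Bool) :
    ((wheelState (m + 2)).symm u).single =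
      (∏ i, if u i then 1 else if xor false i.val.bodd then 0 else 1) +
      (∏ i, if u i then 1 else if xor true i.val.bodd then 0 else 1) -
      2 * ∏ i, if u i then 1 else 0 := by
  have hprod : ∀ b : Bool, (∏ i, if u i then (1 : ℤ) else if xor b i.val.bodd then 0 else 1) =
      if ∀ i, u i = false → xor b i.val.bodd = false then 1 else 0 := by
    intro b
    split_ifs with h
    · refine Finset.prod_eq_one fun i _ => ?_
      cases hi : u i
      · simp [h i hi]
      · rfl
    · push Not at h
      obtain ⟨i, hi, hi'⟩ := h
      refine Finset.prod_eq_zero (Finset.mem_univ i) ?_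
      rw [hi, if_neg (by simp), if_pos (by simpa using hi')]
  rw [hprod, hprod]
  by_cases hu : ∀ i, u i = true
  · rw [wheel_single_eq_zero (not_isTransitive_wheelFace_of_forall (by omega) hu)]
    simp [hu]
  push Not at hu
  obtain ⟨i₀, hi₀⟩ := hu
  have hi₀ : u i₀ = false := by simpa using hi₀
  have h0 : ∏ i, (if u i then (1 : ℤ) else 0) = 0 :=
    Finset.prod_eq_zero (Finset.mem_univ i₀) (by simp [hi₀])
  rw [h0, mul_zero, sub_zero]
  by_cases hc : ∃ b, ∀ i : Fin (m + 2), u i = false → xor b i.val.bodd = false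
  · obtain ⟨b, hb⟩ := hc
    rw [wheel_single_eq_one (isTransitive_wheelFace (isTransitive_finRotate m) ⟨i₀, hi₀⟩
      (isAlternating_xor_bodd hm b) hb)]
    have hb' : ¬ ∀ i : Fin (m + 2), u i = false → xor (!b) i.val.bodd = false := by
      intro h
      have h1 := hb i₀ hi₀
      have h2 := h i₀ hi₀
      cases b <;> simp_all
    cases b
    · rw [if_pos hb, if_neg (by simpa only [Bool.not_false] using hb'), add_zero]
    · rw [if_pos hb, if_neg (by simpa only [Bool.not_true] using hb'), zero_add]
  · rw [wheel_single_eq_zero, if_neg fun h => hc ⟨false, h⟩, if_neg fun h => hc ⟨true, h⟩,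
      add_zero]
    refine not_isTransitive_wheelFace (isTransitive_finRotate m) ⟨i₀, hi₀⟩ ?_
    rintro ⟨c, hc', hc''⟩
    refine hc ⟨c 0, fun i hi => ?_⟩
    rw [← hc'.apply_eq i.val i.isLt]
    exact hc'' i hi

theorem sum_prod_bool {n : ℕ} (f g : Fin n → ℤ) :
    ∑ u : Fin n → Bool, (∏ i, if u i then f i else g i) = ∏ i, (f i + g i) := by
  have h := Finset.prod_univ_sum (fun _ : Fin n => (Finset.univ : Finset Bool))
    (fun i b => if b then f i else g i)
  rw [Fintype.piFinset_univ] at h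
  rw [← h]
  exact Finset.prod_congr rfl fun i _ => by simp

theorem weight_wheel_of_even {m : ℕ} (hm : Even (m + 2)) : (wheel (m + 2)).weight = -2 := by
  have h1 : ∀ (u : Fin (m + 2) → Bool) (g : Fin (m + 2) → ℤ),
      (∏ i, if u i then (-1 : ℤ) else 1) * (∏ i, if u i then 1 else g i) =
        ∏ i, if u i then -1 else g i := by
    intro u g
    rw [← Finset.prod_mul_distrib]
    exact Finset.prod_congr rfl fun i _ => by cases u i <;> simp
  have h2 : ∀ u : Fin (m + 2) → Bool,
      (∏ i, if u i then (-1 : ℤ) else 1) * ((wheelState (m + 2)).symm u).single =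
        (∏ i, if u i then -1 else if xor false i.val.bodd then 0 else 1) +
        (∏ i, if u i then -1 else if xor true i.val.bodd then 0 else 1) -
        2 * ∏ i, if u i then -1 else 0 := by
    intro u
    rw [wheel_single_of_even hm, mul_sub, mul_add, h1, h1, mul_left_comm, h1]
  rw [weight_wheel, Finset.sum_congr rfl fun u _ => h2 u, Finset.sum_sub_distrib,
    Finset.sum_add_distrib, ← Finset.mul_sum, sum_prod_bool, sum_prod_bool, sum_prod_bool,
    -- The factor is `-1 + 1` at any spoke that may be reversed: spoke `0` for the even class, spoke
    -- `1` for the odd one.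
    Finset.prod_eq_zero (Finset.mem_univ (0 : Fin (m + 2))) (by simp),
    Finset.prod_eq_zero (Finset.mem_univ (1 : Fin (m + 2))) (by simp)]
  simp [hm.neg_one_pow]

end Wheel

end AlexanderConway

theorem proposition5p4 (k : Type*) [Field k] (n : ℕ) (hn : 2 ≤ n) :
    (∃! C : AlexanderConway.DiagramSpace k n →ₗ[k] k, AlexanderConway.IsAlexanderConway C) ∧
    ∀ C : AlexanderConway.DiagramSpace k n →ₗ[k] k, AlexanderConway.IsAlexanderConway C →
      (∀ F : AlexanderConway.FeynmanDiagram n, F.IsConnected →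
        AlexanderConway.cls k F ∈ AlexanderConway.legFiltration k n (n - 1) →
          C (AlexanderConway.cls k F) = 0) ∧
      (Even n → C (AlexanderConway.cls k (AlexanderConway.wheel n)) = -2) ∧
      (Odd n → C (AlexanderConway.cls k (AlexanderConway.wheel n)) = 0) := by
  have hW := AlexanderConway.isAlexanderConway_weightFunctional k n
  refine ⟨⟨_, hW, fun C hC => hC.unique hW⟩, fun C hC => ?_⟩
  obtain rfl : C = AlexanderConway.weightFunctional k n := hC.unique hW
  obtain ⟨m, rfl⟩ : ∃ m, n = m + 2 := ⟨n - 2, by omega⟩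
  refine ⟨fun F _ hF => ?_, fun h => ?_, fun h => ?_⟩
  -- Vanishing on diagrams with few legs passes to their span, so only membership of the class in
  -- the subspace matters.
  · have hle : AlexanderConway.legFiltration k (m + 2) (m + 2 - 1) ≤
        LinearMap.ker (AlexanderConway.weightFunctional k (m + 2)) := by
      rw [AlexanderConway.legFiltration, Submodule.span_le]
      rintro a ⟨G, hG, rfl⟩
      rw [SetLike.mem_coe, LinearMap.mem_ker, AlexanderConway.weightFunctional_cls,
        AlexanderConway.FeynmanDiagram.weight_eq_zero_of_numLegs_lt (by omega), Int.cast_zero]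
    exact hle hF
  · rw [AlexanderConway.weightFunctional_cls, AlexanderConway.weight_wheel_of_even h]
    simp
  · rw [AlexanderConway.weightFunctional_cls, AlexanderConway.weight_wheel_of_odd h]
    simp
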